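/- Let $q\in\{0,\tfrac12,1,\tfrac32,\dots\}$ and let $N_\theta>q$, $N_\phi>4q$, $N_\psi>4q$ be positive integers (for example $N_\theta=q+1$ if $q$ is an integer, $N_\theta=q+\tfrac12$ otherwise, and $N_\phi=N_\psi=4q+1$). **Points and weights.** The Legendre polynomial $P_{N_\theta}$ has $N_\theta$ distinct real roots $x_s=\cos\theta_s$, $0\le\theta_s\le\pi$. The Gaussian weights $w_s$ are the unique solution of $\sum_s P_k(x_s)w_s=\delta_{k0}\int_{-1}^1P_0^2\,dx$, $0\le k<N_\theta$; they are positive. Consider the $N_\alpha=N_\theta N_\phi N_\psi$ points $\vec\alpha=(\theta_s,\phi_b,\psi_c)$ with $\phi_b=4\pi b/N_\phi$ $(1\le b\le N_\phi)$ and $\psi_c=4\pi c/N_\psi$ $(1\le c\le N_\psi)$. **Discrete Jacobi transform.** For $j\in\{0,\tfrac12,1,\dots,q\}$ and $m_L,m_R\in\{-j,-j+1,\dots,j\}$ let $D^j_{m_Lm_R}(\vec\alpha)=e^{im_L\phi}d^j_{m_Lm_R}(\theta)e^{im_R\psi}$ be the Wigner functions, where, with $x=\cos\theta$ and $J$ the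 Jacobi polynomials, $$d^j_{m_Lm_R}(\theta)=\Big(\tfrac{(j-m_R)!\,(j+m_R)!}{(j-m_L)!\,(j+m_L)!}\Big)^{1/2}\Big(\tfrac{1-x}2\Big)^{\frac{m_R-m_L}2}\Big(\tfrac{1+x}2\Big)^{\frac{m_R+m_L}2}J^{(m_R-m_L,\,m_R+m_L)}_{j-m_R}(x).$$ Let $V$ be the matrix with rows indexed by the points, columns indexed by the triplets $(j,m_L,m_R)$, and entries $\sqrt{j+\tfrac12}\,\sqrt{w_s/(N_\phi N_\psi)}\;D^j_{m_Lm_R}(\vec\alpha)$. Its columns $\vec v^{\,j}_{m_Lm_R}$ are orthonormal, $V^\dagger V=1$, and $V^{-1}:=V^\dagger$ denotes this left inverse. **Momenta and link.** On the space with basis $|j,m_L,m_R\rangle$, $j\le q$, let $\hat L_a,\hat R_a$ $(a=1,2,3)$ be given by $$\hat L_3|j,m_L,m_R\rangle=m_L|j,m_L,m_R\rangle,\qquad (\hat L_1\pm i\hat L_2)|j,m_L,m_R\rangle=\sqrt{j(j+1)-m_L(m_L\pm1)}\,|j,m_L\pm1,m_R\rangle,$$ $$\hat R_3|j,m_L,m_R\rangle=-m_R|j,m_L,m_R\rangle,\qquad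 (\hat R_1\mp i\hat R_2)|j,m_L,m_R\rangle=-\sqrt{j(j+1)-m_R(m_R\pm1)}\,|j,m_L,m_R\pm1\rangle,$$ and put $L_a=V\hat L_aV^{-1}$, $R_a=V\hat R_aV^{-1}$ (these are $N_\alpha\times N_\alpha$ matrices). Let $\tau_a=\sigma_a/2$ with $\sigma_a$ the Pauli matrices, and let $U=(U_{cd})_{c,d=1,2}$ be the $2\times2$ array of diagonal operators on $\mathbb C^{N_\alpha}$ which at the point $\vec\alpha$ multiply by the entries of $\mathcal U(\vec\alpha)=e^{-i\phi\tau_3}e^{-i\theta\tau_2}e^{-i\psi\tau_3}$. **Claim.** One has $\sum_aL_a^2=\sum_aR_a^2$, and each column $\vec v^{\,j}_{m_Lm_R}$, $j\le q$, is a joint eigenvector of $\sum_aL_a^2$, $L_3$ and $R_3$ with eigenvalues $j(j+1)$, $m_L$ and $-m_R$. The columns with $j\le q-\tfrac12$ (the "first $N_{q-1/2}$ eigenvectors") span a subspace of dimension $N_{q-1/2}=\tfrac16(4q'+3)(2q'+2)(2q'+1)$, $q'=q-\tfrac12$, and the canonical commutation relations hold exactly on it: for every $\vec\Phi$ in this subspace,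 all $a\in\{1,2,3\}$ and all $c,d\in\{1,2\}$, $$[L_a,U_{cd}]\,\vec\Phi=-\sum_e(\tau_a)_{ce}U_{ed}\,\vec\Phi,\qquad [R_a,U_{cd}]\,\vec\Phi=\sum_eU_{ce}(\tau_a)_{ed}\,\vec\Phi,$$ that is, $[L_a,U]=-\tau_aU$ and $[R_a,U]=U\tau_a$ on it. -/

import Mathlib

open scoped Matrix

noncomputable section

namespace DJT

/-! ### Legendre partitioning, Gaussian weights -/

/-- The Legendre polynomial `P_n`, by Rodrigues' formula: the orthogonal polynomials on `[-1, 1]`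
for the weight function `ω = 1`. -/
def legendre (n : ℕ) : Polynomial ℝ :=
  Polynomial.C ((2 ^ n * (n.factorial : ℝ))⁻¹) *
    Polynomial.derivative^[n] ((Polynomial.X ^ 2 - 1) ^ n)

/-- The nodes `x_s = cos θ_s`: the roots of `P_N`. -/
abbrev Node (N : ℕ) : Type := {x : ℝ // x ∈ (legendre N).roots.toFinset}

/-- The polar angle `θ_s ∈ [0, π]` of a node. -/
def nodeAngle {N : ℕ} (s : Node N) : ℝ := Real.arccos s.1

/-- `w` solves the linear system that defines the Gaussian weights:
`∑_s P_k(x_s) w_s = ⟨P_0, P_0⟩` if `k = 0`, and `= 0` if `k = 1, …, N - 1`. -/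
def IsGaussianWeights (N : ℕ) (w : Node N → ℝ) : Prop :=
  ∀ k < N, ∑ s : Node N, (legendre k).eval s.1 * w s =
    if k = 0 then ∫ x in (-1 : ℝ)..1, (legendre 0).eval x * (legendre 0).eval x else 0

/-- The points `(θ_s, φ_b, ψ_c)` of the partitioning of the 3-sphere. -/
abbrev Point (Nθ Nφ Nψ : ℕ) : Type := Node Nθ × Fin Nφ × Fin Nψ

/-- `N` equidistant angles `4 π b / N`, `b = 1, …, N`. -/
def circleAngle {N : ℕ} (b : Fin N) : ℝ := 4 * Real.pi * ((b : ℕ) + 1 : ℝ) / N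

/-! ### Wigner functions -/

/-- The Jacobi polynomial `P_n^{(α, β)}(x)` with integer parameters,
`∑_s C(n + α, n - s) C(n + β, s) ((x - 1) / 2)^s ((x + 1) / 2)^(n - s)`,
where `C` is the generalized binomial coefficient. -/
def jacobi (n : ℕ) (α β : ℤ) (x : ℝ) : ℝ :=
  ∑ s ∈ Finset.range (n + 1),
    ((Ring.choose ((n : ℤ) + α) (n - s) : ℤ) : ℝ) * ((Ring.choose ((n : ℤ) + β) s : ℤ) : ℝ) *
      ((x - 1) / 2) ^ s * ((x + 1) / 2) ^ (n - s)

/-- The triplets `(j, m_L, m_R)` with `j = 0, 1/2, 1, …, Q/2` and `m_L, m_R = -j, …, j`, encoded by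
the natural numbers `2 j`, `j + m_L`, `j + m_R`. -/
abbrev Triplet (Q : ℕ) : Type := Σ k : Fin (Q + 1), Fin (k.1 + 1) × Fin (k.1 + 1)

namespace Triplet

variable {Q : ℕ}

/-- The natural number `2 j`. -/
def twoJ (t : Triplet Q) : ℕ := t.1.1

/-- The natural number `j + m_L`. -/
def left (t : Triplet Q) : ℕ := t.2.1.1

/-- The natural number `j + m_R`. -/
def right (t : Triplet Q) : ℕ := t.2.2.1

/-- The main quantum number `j`. -/
def j (t : Triplet Q) : ℝ := (t.twoJ : ℝ) / 2

/-- The left magnetic quantum number `m_L`. -/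
def mL (t : Triplet Q) : ℝ := (t.left : ℝ) - t.j

/-- The right magnetic quantum number `m_R`. -/
def mR (t : Triplet Q) : ℝ := (t.right : ℝ) - t.j

end Triplet

/-- The Wigner d-function
`d^j_{m_L m_R}(θ) = ((j+m_R)! (j-m_R)! / ((j+m_L)! (j-m_L)!))^{1/2} ((1-x)/2)^{(m_R-m_L)/2}`
`((1+x)/2)^{(m_R+m_L)/2} P_{j-m_R}^{(m_R-m_L, m_R+m_L)}(x)`, with `x = cos θ`. -/
def wignerd {Q : ℕ} (t : Triplet Q) (θ : ℝ) : ℝ :=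
  Real.sqrt (((t.right.factorial : ℝ) * ((t.twoJ - t.right).factorial : ℝ)) /
      ((t.left.factorial : ℝ) * ((t.twoJ - t.left).factorial : ℝ))) *
    ((1 - Real.cos θ) / 2) ^ ((t.mR - t.mL) / 2) *
    ((1 + Real.cos θ) / 2) ^ ((t.mR + t.mL) / 2) *
    jacobi (t.twoJ - t.right) ((t.right : ℤ) - t.left) ((t.right : ℤ) + t.left - t.twoJ)
      (Real.cos θ)

/-- The Wigner D-function `D^j_{m_L m_R} = e^{i m_L φ} d^j_{m_L m_R}(θ) e^{i m_R ψ}`. -/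
def wignerD {Q : ℕ} (t : Triplet Q) (θ φ ψ : ℝ) : ℂ :=
  Complex.exp (Complex.I * t.mL * φ) * (wignerd t θ : ℂ) * Complex.exp (Complex.I * t.mR * ψ)

/-! ### The discrete Jacobi transform -/

/-- The matrix `V = DJT` of the discrete Jacobi transform, with `q = Q / 2`. -/
def djt (Q : ℕ) {Nθ : ℕ} (Nφ Nψ : ℕ) (w : Node Nθ → ℝ) : Matrix (Point Nθ Nφ Nψ) (Triplet Q) ℂ :=
  Matrix.of fun p t =>
    (Real.sqrt (t.j + 1 / 2) : ℂ) * (Real.sqrt (w p.1 / ((Nφ : ℝ) * (Nψ : ℝ))) : ℂ) *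
      wignerD t (nodeAngle p.1) (circleAngle p.2.1) (circleAngle p.2.2)

/-! ### The momenta in the truncated electric basis -/

/-- `L̂_1 + i L̂_2`: `|j, m_L, m_R⟩ ↦ √(j(j+1) - m_L(m_L+1)) |j, m_L + 1, m_R⟩`. -/
def hatLPlus (Q : ℕ) : Matrix (Triplet Q) (Triplet Q) ℂ :=
  Matrix.of fun t' t =>
    if t'.twoJ = t.twoJ ∧ t'.left = t.left + 1 ∧ t'.right = t.right then
      (Real.sqrt (t.j * (t.j + 1) - t.mL * (t.mL + 1)) : ℂ) else 0

/-- `L̂_1 - i L̂_2`: `|j, m_L, m_R⟩ ↦ √(j(j+1) - m_L(m_L-1)) |j, m_L - 1, m_R⟩`. -/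
def hatLMinus (Q : ℕ) : Matrix (Triplet Q) (Triplet Q) ℂ :=
  Matrix.of fun t' t =>
    if t'.twoJ = t.twoJ ∧ t'.left + 1 = t.left ∧ t'.right = t.right then
      (Real.sqrt (t.j * (t.j + 1) - t.mL * (t.mL - 1)) : ℂ) else 0

/-- `R̂_1 - i R̂_2`: `|j, m_L, m_R⟩ ↦ -√(j(j+1) - m_R(m_R+1)) |j, m_L, m_R + 1⟩`. -/
def hatRMinus (Q : ℕ) : Matrix (Triplet Q) (Triplet Q) ℂ :=
  Matrix.of fun t' t =>
    if t'.twoJ = t.twoJ ∧ t'.left = t.left ∧ t'.right = t.right + 1 then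
      -(Real.sqrt (t.j * (t.j + 1) - t.mR * (t.mR + 1)) : ℂ) else 0

/-- `R̂_1 + i R̂_2`: `|j, m_L, m_R⟩ ↦ -√(j(j+1) - m_R(m_R-1)) |j, m_L, m_R - 1⟩`. -/
def hatRPlus (Q : ℕ) : Matrix (Triplet Q) (Triplet Q) ℂ :=
  Matrix.of fun t' t =>
    if t'.twoJ = t.twoJ ∧ t'.left = t.left ∧ t'.right + 1 = t.right then
      -(Real.sqrt (t.j * (t.j + 1) - t.mR * (t.mR - 1)) : ℂ) else 0

/-- The matrices `L̂_1, L̂_2, L̂_3` (indices `0, 1, 2`). -/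
def hatL (Q : ℕ) : Fin 3 → Matrix (Triplet Q) (Triplet Q) ℂ :=
  ![(1 / 2 : ℂ) • (hatLPlus Q + hatLMinus Q),
    (1 / (2 * Complex.I) : ℂ) • (hatLPlus Q - hatLMinus Q),
    Matrix.diagonal fun t => (t.mL : ℂ)]

/-- The matrices `R̂_1, R̂_2, R̂_3` (indices `0, 1, 2`); `R̂_3 |j, m_L, m_R⟩ = -m_R |j, m_L, m_R⟩`. -/
def hatR (Q : ℕ) : Fin 3 → Matrix (Triplet Q) (Triplet Q) ℂ :=
  ![(1 / 2 : ℂ) • (hatRPlus Q + hatRMinus Q),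
    (1 / (2 * Complex.I) : ℂ) • (hatRPlus Q - hatRMinus Q),
    Matrix.diagonal fun t => -(t.mR : ℂ)]

/-! ### The operators in the magnetic basis -/

/-- `L_a = V L̂_a V⁻¹`, where `V⁻¹ = V†` is the left inverse of `V`, whose columns are
orthonormal. -/
def momL (Q : ℕ) {Nθ : ℕ} (Nφ Nψ : ℕ) (w : Node Nθ → ℝ) (a : Fin 3) :
    Matrix (Point Nθ Nφ Nψ) (Point Nθ Nφ Nψ) ℂ :=
  djt Q Nφ Nψ w * hatL Q a * (djt Q Nφ Nψ w)ᴴ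

/-- `R_a = V R̂_a V⁻¹`, where `V⁻¹ = V†`. -/
def momR (Q : ℕ) {Nθ : ℕ} (Nφ Nψ : ℕ) (w : Node Nθ → ℝ) (a : Fin 3) :
    Matrix (Point Nθ Nφ Nψ) (Point Nθ Nφ Nψ) ℂ :=
  djt Q Nφ Nψ w * hatR Q a * (djt Q Nφ Nψ w)ᴴ

/-- The generators `τ_a = σ_a / 2` (indices `0, 1, 2`). -/
def tau : Fin 3 → Matrix (Fin 2) (Fin 2) ℂ :=
  ![(1 / 2 : ℂ) • !![0, 1; 1, 0],
    (1 / 2 : ℂ) • !![0, -Complex.I; Complex.I, 0],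
    (1 / 2 : ℂ) • !![1, 0; 0, -1]]

/-- The element `e^{-i φ τ_3} e^{-i θ τ_2} e^{-i ψ τ_3}` of SU(2) with Euler angles `θ, φ, ψ`. -/
def su2 (θ φ ψ : ℝ) : Matrix (Fin 2) (Fin 2) ℂ :=
  !![Real.cos (θ / 2) * Complex.exp (-Complex.I * (φ + ψ) / 2),
     -Real.sin (θ / 2) * Complex.exp (-Complex.I * (φ - ψ) / 2);
     Real.sin (θ / 2) * Complex.exp (Complex.I * (φ - ψ) / 2),
     Real.cos (θ / 2) * Complex.exp (Complex.I * (φ + ψ) / 2)]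

/-- The link operator `U`: a 2 × 2 array of operators that are diagonal in the magnetic basis. -/
def link (Nθ Nφ Nψ : ℕ) (c d : Fin 2) : Matrix (Point Nθ Nφ Nψ) (Point Nθ Nφ Nψ) ℂ :=
  Matrix.diagonal fun p =>
    su2 (nodeAngle p.1) (circleAngle p.2.1) (circleAngle p.2.2) c d

/-- The span of the columns `v^j_{m_L m_R}` of `V` with `2 j < Q = 2 q`, i.e. `j ≤ q - 1/2`. -/
def lowSpace (Q : ℕ) {Nθ : ℕ} (Nφ Nψ : ℕ) (w : Node Nθ → ℝ) :
    Submodule ℂ (Point Nθ Nφ Nψ → ℂ) :=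
  Submodule.span ℂ {v | ∃ t : Triplet Q, t.twoJ < Q ∧ v = (djt Q Nφ Nψ w).col t}

end DJT

end

/-!
Up to normalization, the Wigner functions are the matrix coefficients of the symmetric powers of the
defining representation of SU(2). With `l = j + m_L`, `l' = j - m_L` and `z = j - m_R`, the function
`D^j_{m_L m_R}` is proportional to the coefficient of `Z^z` in the binary form
`(g₂₂ - g₂₁ Z)ˡ (-g₁₂ + g₁₁ Z)ˡ'` of the matrix `g` with the given Euler angles (`wignerD_eq`).
Differentiating this form in `Z` and using `det g = 1` expands each product of an entry of `g` with
a coefficient of spin `j` in two coefficients, of spins `j + 1/2` and `j - 1/2`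
(`mul_symCoeff_zero_zero` and its three companions). Everything else follows from these expansions.

Orthonormality of the columns (`symInner_eq`) is proved by induction on the degree `l + l'` of the
left factor of an inner product. Since `g` is unitary, a linear factor can be moved to the right
vector, where the expansions apply; the total degree does not grow beyond `4 q`. When no
factor is left, the inner product is the discrete average of one coefficient. The equidistant angles
annihilate it unless `l = l' = z`, and then it is the Legendre polynomial `P_l` at the nodes
(`symCoeff_su2_zero_eq_legendre`), which Gaussian quadrature integrates exactly
(`IsGaussianWeights.quadrature_eq`). The reality and simplicity of the nodes come from Rolle's
theorem (`le_card_roots_iterate_derivative`), the positivity of the weights and the location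
of the nodes from exactness on the squares of the Lagrange basis polynomials.

As `V† V = 1`, the momenta act on the columns of `V` as their matrices act on the electric basis. On
the unnormalized coefficients this action has no square roots (`hatLPlus_mulVec` and its
companions). On the columns with `j ≤ q - 1/2` multiplication by `U` does not leave the span of the
columns of `V`, so that both sides of the commutation relations can be computed by the expansions
and compared term by term.
-/

open scoped Matrix

noncomputable section

namespace DJT

/-! ### Legendre polynomials: degree, orthogonality, real simple roots -/

open Polynomial in
lemma monic_X_sq_sub_one_pow (n : ℕ) : ((X ^ 2 - 1 : ℝ[X]) ^ n).Monic :=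
  (monic_X_pow_sub_C (1 : ℝ) two_ne_zero).pow n

open Polynomial in
lemma natDegree_X_sq_sub_one_pow (n : ℕ) : ((X ^ 2 - 1 : ℝ[X]) ^ n).natDegree = n * 2 := by
  rw [natDegree_pow]; congr 1; exact natDegree_X_pow_sub_C (n := 2) (r := (1 : ℝ))

open Polynomial in
lemma iterate_derivative_X_sq_sub_one_pow_ne_zero {n k : ℕ} (hk : k ≤ n) :
    derivative^[k] ((X ^ 2 - 1 : ℝ[X]) ^ n) ≠ 0 := by
  intro h
  have hm := monic_X_sq_sub_one_pow n
  have hd := natDegree_X_sq_sub_one_pow n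
  have h1 := congrArg (fun p => coeff p (n * 2 - k)) h
  simp only [coeff_iterate_derivative, coeff_zero] at h1
  rw [Nat.sub_add_cancel (by omega), ← hd, hm.coeff_natDegree, hd, nsmul_one, Nat.cast_eq_zero,
    Nat.descFactorial_eq_zero_iff_lt] at h1
  omega

lemma legendre_scalar_ne_zero (n : ℕ) : ((2 ^ n * (n.factorial : ℝ))⁻¹) ≠ 0 := by positivity

lemma legendre_ne_zero (n : ℕ) : legendre n ≠ 0 :=
  mul_ne_zero (by simpa using (legendre_scalar_ne_zero n))
    (iterate_derivative_X_sq_sub_one_pow_ne_zero le_rfl)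

open Polynomial in
lemma natDegree_legendre (n : ℕ) : (legendre n).natDegree = n := by
  have hm := monic_X_sq_sub_one_pow n
  have hd := natDegree_X_sq_sub_one_pow n
  rw [legendre, natDegree_C_mul (legendre_scalar_ne_zero n)]
  refine natDegree_eq_of_le_of_coeff_ne_zero
    ((natDegree_iterate_derivative _ _).trans (by rw [hd]; omega)) ?_
  rw [coeff_iterate_derivative, ← mul_two, ← hd, hm.coeff_natDegree, hd, nsmul_one,
    Nat.cast_ne_zero, Ne, Nat.descFactorial_eq_zero_iff_lt]
  omega

lemma degree_legendre (n : ℕ) : (legendre n).degree = n := by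
  rw [Polynomial.degree_eq_natDegree (legendre_ne_zero n), natDegree_legendre]

lemma legendre_zero : legendre 0 = 1 := by simp [legendre]

open Polynomial in
lemma isRoot_iterate_derivative_X_sq_sub_one_pow {n k : ℕ} (hk : k < n) {x : ℝ} (hx : x ^ 2 = 1) :
    (derivative^[k] ((X ^ 2 - 1 : ℝ[X]) ^ n)).eval x = 0 := by
  obtain ⟨r, hr⟩ := pow_sub_dvd_iterate_derivative_pow (X ^ 2 - 1 : ℝ[X]) n k
  rw [hr, eval_mul, eval_pow]
  simp [hx, Nat.sub_ne_zero_of_lt hk]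

open Polynomial in
/-- Before its `n`-th derivative, each derivative of `(X² - 1)ⁿ` still vanishes at `±1`, so Rolle's
theorem produces one more distinct root with every differentiation. -/
lemma le_card_roots_iterate_derivative {n k : ℕ} (hk : k < n) :
    k + 2 ≤ (derivative^[k] ((X ^ 2 - 1 : ℝ[X]) ^ n)).roots.toFinset.card := by
  have hmem : ∀ i < n, ({1, -1} : Finset ℝ) ⊆
      (derivative^[i] ((X ^ 2 - 1 : ℝ[X]) ^ n)).roots.toFinset := by
    intro i hi x hx
    rw [Multiset.mem_toFinset, mem_roots (iterate_derivative_X_sq_sub_one_pow_ne_zero hi.le)]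
    refine isRoot_iterate_derivative_X_sq_sub_one_pow hi ?_
    rcases Finset.mem_insert.1 hx with rfl | hx
    · norm_num
    · rw [Finset.mem_singleton.1 hx]; norm_num
  have hpair : ({1, -1} : Finset ℝ).card = 2 := Finset.card_pair (by norm_num)
  induction k with
  | zero => simpa [hpair] using Finset.card_le_card (hmem 0 hk)
  | succ k ih =>
    have h1 := ih (by omega)
    have h2 := card_roots_toFinset_le_card_roots_derivative_sdiff_roots_succ
      (derivative^[k] ((X ^ 2 - 1 : ℝ[X]) ^ n))
    rw [← Function.iterate_succ_apply' derivative] at h2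
    have h3 := hmem k (by omega)
    have h4 := hmem (k + 1) hk
    have h5 := Finset.card_sdiff_add_card_inter
      (derivative^[k + 1] ((X ^ 2 - 1 : ℝ[X]) ^ n)).roots.toFinset
      (derivative^[k] ((X ^ 2 - 1 : ℝ[X]) ^ n)).roots.toFinset
    have h6 := Finset.card_le_card (Finset.subset_inter h4 h3)
    simp only [Nat.succ_eq_add_one] at h2
    omega

open Polynomial in
lemma card_node (N : ℕ) : Fintype.card (Node N) = N := by
  rw [Fintype.card_coe]
  apply le_antisymm
  · exact (Multiset.toFinset_card_le _).trans ((card_roots' _).trans (natDegree_legendre N).le)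
  · rcases N with _ | n
    · simp
    · have h1 := le_card_roots_iterate_derivative (Nat.lt_succ_self n)
      have h2 := card_roots_toFinset_le_card_roots_derivative_sdiff_roots_succ
        (derivative^[n] ((X ^ 2 - 1 : ℝ[X]) ^ (n + 1)))
      rw [← Function.iterate_succ_apply' derivative] at h2
      rw [legendre, roots_C_mul _ (legendre_scalar_ne_zero _)]
      have h3 := Finset.card_le_card (Finset.sdiff_subset
        (s := (derivative^[n + 1] ((X ^ 2 - 1 : ℝ[X]) ^ (n + 1))).roots.toFinset)
        (t := (derivative^[n] ((X ^ 2 - 1 : ℝ[X]) ^ (n + 1))).roots.toFinset))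
      simp only [Nat.succ_eq_add_one] at h2 h1
      omega

/-- The linear functional `p ↦ ∫_{-1}^1 p(x) dx` on real polynomials. -/
def integral : Polynomial ℝ →ₗ[ℝ] ℝ where
  toFun p := ∫ x in (-1 : ℝ)..1, p.eval x
  map_add' p q := by
    simp only [Polynomial.eval_add]
    exact intervalIntegral.integral_add (p.continuous.intervalIntegrable _ _)
      (q.continuous.intervalIntegrable _ _)
  map_smul' c p := by simp

lemma integral_apply (p : Polynomial ℝ) : integral p = ∫ x in (-1 : ℝ)..1, p.eval x := rfl

lemma integral_derivative (p : Polynomial ℝ) :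
    integral (Polynomial.derivative p) = p.eval 1 - p.eval (-1) :=
  intervalIntegral.integral_eq_sub_of_hasDerivAt (fun x _ => p.hasDerivAt x)
    ((Polynomial.continuous _).intervalIntegrable _ _)

lemma integral_pos {p : Polynomial ℝ} (h0 : p ≠ 0) (h : ∀ x ∈ Set.Icc (-1 : ℝ) 1, 0 ≤ p.eval x) :
    0 < integral p := by
  refine intervalIntegral.integral_pos (by norm_num) p.continuous.continuousOn
    (fun x hx => h x ⟨hx.1.le, hx.2⟩) ?_
  by_contra! hcon
  exact h0 (Polynomial.eq_zero_of_infinite_isRoot p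
    ((Set.Icc_infinite (by norm_num : (-1 : ℝ) < 1)).mono
      fun x hx => le_antisymm (hcon x hx) (h x hx)))

open Polynomial in
/-- Repeated integration by parts: the boundary terms vanish because the derivatives of
`(X² - 1)ⁿ` of order less than `n` vanish at `±1`. -/
lemma integral_iterate_derivative_mul {n k : ℕ} (hk : k ≤ n) (q : ℝ[X])
    (hq : derivative^[k] q = 0) :
    integral (derivative^[k] ((X ^ 2 - 1 : ℝ[X]) ^ n) * q) = 0 := by
  induction k generalizing q with
  | zero => simp at hq; simp [hq]
  | succ k ih =>
    have h1 := ih (by omega) (derivative q) (by rwa [← Function.iterate_succ_apply])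
    have h2 := integral_derivative (derivative^[k] ((X ^ 2 - 1 : ℝ[X]) ^ n) * q)
    rw [derivative_mul, map_add, h1, eval_mul, eval_mul,
      isRoot_iterate_derivative_X_sq_sub_one_pow hk (by norm_num),
      isRoot_iterate_derivative_X_sq_sub_one_pow hk (by norm_num)] at h2
    rw [Function.iterate_succ_apply']
    simpa using h2

open Polynomial in
lemma integral_legendre_mul {n : ℕ} {q : ℝ[X]} (hq : q.degree < n) :
    integral (legendre n * q) = 0 := by
  rw [legendre, mul_assoc, ← smul_eq_C_mul, map_smul, integral_iterate_derivative_mul le_rfl,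
    smul_zero]
  exact iterate_derivative_eq_zero_of_degree_lt hq

lemma integral_one : integral 1 = 2 := by
  rw [integral_apply]; norm_num

lemma integral_legendre (n : ℕ) : integral (legendre n) = if n = 0 then 2 else 0 := by
  split_ifs with h
  · rw [h, legendre_zero, integral_one]
  · have := integral_legendre_mul (n := n) (q := 1)
      (by rw [Polynomial.degree_one]; exact_mod_cast Nat.pos_of_ne_zero h)
    rwa [mul_one] at this

open Polynomial in
/-- `P_m` in the form `∑ᵢ C(m, i)² ((x - 1)/2)ⁱ ((x + 1)/2)ᵐ⁻ⁱ`, by Leibniz' rule for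
`(X - 1)ᵐ (X + 1)ᵐ`. -/
lemma eval_legendre (m : ℕ) (x : ℝ) : (legendre m).eval x =
    ∑ i ∈ Finset.range (m + 1), (m.choose i : ℝ) ^ 2 * ((x - 1) / 2) ^ i *
      ((x + 1) / 2) ^ (m - i) := by
  have h : (X ^ 2 - 1 : ℝ[X]) ^ m = (X - C 1) ^ m * (X + C 1) ^ m := by
    rw [← mul_pow]; congr 1; simp; ring
  rw [legendre, h, iterate_derivative_mul, eval_mul, eval_C, eval_finsetSum, Finset.mul_sum]
  refine Finset.sum_congr rfl fun i hi => ?_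
  have hi' : i ≤ m := Nat.lt_succ_iff.1 (Finset.mem_range.1 hi)
  rw [iterate_derivative_X_sub_pow, iterate_derivative_X_add_pow]
  simp only [nsmul_eq_mul, eval_mul, eval_natCast, eval_pow, eval_sub, eval_add, eval_X, eval_C]
  have h1 : ((m.descFactorial i : ℕ) : ℝ) = i.factorial * m.choose i := by
    exact_mod_cast Nat.descFactorial_eq_factorial_mul_choose m i
  have h2 : ((m.descFactorial (m - i) : ℕ) : ℝ) = (m - i).factorial * m.choose i := by
    rw [← Nat.choose_symm hi']
    exact_mod_cast Nat.descFactorial_eq_factorial_mul_choose m (m - i)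
  have h3 : (m.factorial : ℝ) = m.choose i * i.factorial * (m - i).factorial := by
    exact_mod_cast (Nat.choose_mul_factorial_mul_factorial hi').symm
  have h4 : (2 : ℝ) ^ m = 2 ^ i * 2 ^ (m - i) := by rw [← pow_add, Nat.add_sub_cancel' hi']
  have h5 : (m.choose i : ℝ) ≠ 0 := by exact_mod_cast (Nat.choose_pos hi').ne'
  rw [h1, h2, h3, h4, Nat.sub_sub_self hi', div_pow, div_pow]
  field_simp

/-! ### Gaussian quadrature -/

open Polynomial in
/-- A linear functional that vanishes on `P_0, …, P_{N-1}` vanishes on all polynomials of degree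
less than `N`. -/
lemma eq_zero_of_legendre {N : ℕ} (F : ℝ[X] →ₗ[ℝ] ℝ) (hF : ∀ k < N, F (legendre k) = 0)
    (p : ℝ[X]) (hp : p.degree < N) : F p = 0 := by
  induction hd : p.natDegree using Nat.strong_induction_on generalizing p with
  | _ d ih =>
    by_cases h0 : p = 0
    · simp [h0]
    have hdN : d < N := by
      rw [degree_eq_natDegree h0, hd] at hp; exact_mod_cast hp
    set c := p.leadingCoeff / (legendre d).leadingCoeff with hc
    have hl : (legendre d).leadingCoeff ≠ 0 := leadingCoeff_ne_zero.2 (legendre_ne_zero d)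
    have hc0 : c ≠ 0 := div_ne_zero (leadingCoeff_ne_zero.2 h0) hl
    have hdeg : (p - C c * legendre d).degree < p.degree := by
      apply degree_sub_lt_left _ h0
      · rw [leadingCoeff_mul, leadingCoeff_C, hc, div_mul_cancel₀ _ hl]
      · rw [degree_C_mul hc0, degree_legendre, degree_eq_natDegree h0, hd]
    have hF' : F p = F (p - C c * legendre d) := by
      rw [map_sub, ← smul_eq_C_mul, map_smul, hF d hdN, smul_zero, sub_zero]
    rw [hF']
    by_cases h1 : p - C c * legendre d = 0
    · simp [h1]
    · exact ih _ (lt_of_lt_of_eq (natDegree_lt_natDegree h1 hdeg) hd) _ (hdeg.trans hp) rfl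

lemma isGaussianWeights_iff {N : ℕ} {w : Node N → ℝ} : IsGaussianWeights N w ↔
    ∀ k < N, ∑ s : Node N, (legendre k).eval s.1 * w s = integral (legendre k) := by
  have h : (∫ x in (-1 : ℝ)..1, (legendre 0).eval x * (legendre 0).eval x) = 2 := by
    rw [legendre_zero]; norm_num
  simp only [IsGaussianWeights, h, integral_legendre]

/-- The quadrature `p ↦ ∑_s p(x_s) w_s` as a linear functional. -/
def quadrature {N : ℕ} (w : Node N → ℝ) : Polynomial ℝ →ₗ[ℝ] ℝ where
  toFun p := ∑ s : Node N, p.eval s.1 * w s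
  map_add' p q := by simp [add_mul, Finset.sum_add_distrib]
  map_smul' c p := by simp [Finset.mul_sum, mul_assoc]

lemma quadrature_apply {N : ℕ} (w : Node N → ℝ) (p : Polynomial ℝ) :
    quadrature w p = ∑ s : Node N, p.eval s.1 * w s := rfl

lemma IsGaussianWeights.quadrature_eq_of_degree_lt {N : ℕ} {w : Node N → ℝ}
    (hw : IsGaussianWeights N w) {p : Polynomial ℝ} (hp : p.degree < N) :
    quadrature w p = integral p := by
  have := eq_zero_of_legendre (quadrature w - integral)
    (fun k hk => by
      rw [LinearMap.sub_apply, quadrature_apply, isGaussianWeights_iff.1 hw k hk, sub_self]) p hp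
  rwa [LinearMap.sub_apply, sub_eq_zero] at this

lemma eval_legendre_node {N : ℕ} (s : Node N) : (legendre N).eval s.1 = 0 :=
  Polynomial.isRoot_of_mem_roots (Multiset.mem_toFinset.1 s.2)

open Polynomial in
/-- Gaussian quadrature with `N` nodes is exact up to degree `2 N - 1`: divide by `P_N`, which
vanishes at the nodes and is orthogonal to the quotient. -/
lemma IsGaussianWeights.quadrature_eq {N : ℕ} {w : Node N → ℝ}
    (hw : IsGaussianWeights N w) {p : ℝ[X]} (hp : p.natDegree < 2 * N) :
    quadrature w p = integral p := by
  have hdiv : legendre N * (p / legendre N) + p % legendre N = p := EuclideanDomain.div_add_mod _ _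
  have hmod : (p % legendre N).degree < N := by
    have := degree_mod_lt p (legendre_ne_zero N); rwa [degree_legendre] at this
  have hquo : (p / legendre N).degree < N := by
    by_cases h0 : p / legendre N = 0
    · rw [h0, degree_zero]; exact WithBot.bot_lt_coe N
    · have h1 : (legendre N * (p / legendre N)).degree = (N + (p / legendre N).natDegree : ℕ) := by
        rw [degree_mul, degree_legendre, degree_eq_natDegree h0]; rfl
      have h2 : (p % legendre N).degree < (legendre N * (p / legendre N)).degree := by
        rw [h1]; exact hmod.trans_le (by exact_mod_cast Nat.le_add_right _ _)
      have h3 := degree_add_eq_left_of_degree_lt h2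
      rw [hdiv, h1] at h3
      have h4 := natDegree_eq_of_degree_eq_some h3
      rw [degree_eq_natDegree h0]
      exact_mod_cast (by omega : (p / legendre N).natDegree < N)
  have hq : quadrature w (legendre N * (p / legendre N)) = 0 := by
    simp [quadrature_apply, eval_legendre_node]
  rw [← hdiv, map_add, map_add, hq, integral_legendre_mul hquo,
    hw.quadrature_eq_of_degree_lt hmod]

/-- The Lagrange basis polynomials of the nodes. -/
def nodeBasis {N : ℕ} (s : Node N) : Polynomial ℝ :=
  Lagrange.basis Finset.univ (fun t : Node N => (t : ℝ)) s

lemma injOn_node (N : ℕ) :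
    Set.InjOn (fun t : Node N => (t : ℝ)) (Finset.univ : Finset (Node N)) :=
  Subtype.val_injective.injOn

lemma degree_nodeBasis {N : ℕ} (s : Node N) : (nodeBasis s).degree = ((N - 1 : ℕ) : WithBot ℕ) := by
  rw [nodeBasis, Lagrange.degree_basis (injOn_node N) (Finset.mem_univ s), Finset.card_univ,
    card_node]

lemma node_pos {N : ℕ} (s : Node N) : 0 < N := by
  rw [← card_node N]; exact Fintype.card_pos_iff.2 ⟨s⟩

lemma eval_nodeBasis {N : ℕ} (s t : Node N) :
    (nodeBasis s).eval (t : ℝ) = if s = t then 1 else 0 := by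
  split_ifs with h
  · subst h
    exact Lagrange.eval_basis_self (v := fun t : Node N => (t : ℝ)) (injOn_node N)
      (Finset.mem_univ s)
  · exact Lagrange.eval_basis_of_ne (v := fun t : Node N => (t : ℝ)) h (Finset.mem_univ t)

lemma nodeBasis_ne_zero {N : ℕ} (s : Node N) : nodeBasis s ≠ 0 := by
  intro h
  have := eval_nodeBasis s s
  simp [h] at this

lemma natDegree_nodeBasis {N : ℕ} (s : Node N) : (nodeBasis s).natDegree = N - 1 :=
  Polynomial.natDegree_eq_of_degree_eq_some (degree_nodeBasis s)

lemma quadrature_nodeBasis_mul {N : ℕ} (w : Node N → ℝ) (s : Node N) (p : Polynomial ℝ) :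
    quadrature w (nodeBasis s * p) = p.eval s.1 * w s := by
  simp [quadrature_apply, eval_nodeBasis]

lemma existsUnique_isGaussianWeights (N : ℕ) : ∃! w : Node N → ℝ, IsGaussianWeights N w := by
  refine ⟨fun s => integral (nodeBasis s), ?_, ?_⟩
  · refine isGaussianWeights_iff.2 fun k hk => ?_
    have h := Lagrange.eq_interpolate (injOn_node N) (f := legendre k)
      (by rw [degree_legendre, Finset.card_univ, card_node]; exact_mod_cast hk)
    rw [Lagrange.interpolate_apply] at h
    conv_rhs => rw [h, map_sum]
    refine Finset.sum_congr rfl fun s _ => ?_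
    rw [← Polynomial.smul_eq_C_mul, map_smul, smul_eq_mul]; rfl
  · intro w hw
    funext s
    have hN := node_pos s
    have := hw.quadrature_eq_of_degree_lt (p := nodeBasis s)
      (by rw [degree_nodeBasis]; exact_mod_cast (by omega : N - 1 < N))
    rw [← this]
    simpa using (quadrature_nodeBasis_mul w s 1).symm

/-- `w_s = ∫ ℓ_s²`, where `ℓ_s` is the Lagrange basis polynomial of the node. -/
lemma IsGaussianWeights.eq_integral_sq {N : ℕ} {w : Node N → ℝ} (hw : IsGaussianWeights N w)
    (s : Node N) : w s = integral (nodeBasis s * nodeBasis s) := by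
  have hN := node_pos s
  rw [← hw.quadrature_eq, quadrature_nodeBasis_mul, eval_nodeBasis, if_pos rfl, one_mul]
  rw [Polynomial.natDegree_mul (nodeBasis_ne_zero s) (nodeBasis_ne_zero s), natDegree_nodeBasis]
  omega

lemma IsGaussianWeights.pos {N : ℕ} {w : Node N → ℝ} (hw : IsGaussianWeights N w)
    (s : Node N) : 0 < w s := by
  rw [hw.eq_integral_sq s]
  refine integral_pos (mul_ne_zero (nodeBasis_ne_zero s) (nodeBasis_ne_zero s)) fun x _ => ?_
  rw [Polynomial.eval_mul]; exact mul_self_nonneg _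

open Polynomial in
/-- The nodes lie strictly between `-1` and `1`: by exactness, `(1 ± x_s) w_s = ∫ (1 ± x) ℓ_s² > 0`,
where `ℓ_s` is the Lagrange basis polynomial of the node. -/
lemma node_mem_Ioo {N : ℕ} (s : Node N) : (s : ℝ) ∈ Set.Ioo (-1 : ℝ) 1 := by
  obtain ⟨w, hw, -⟩ := existsUnique_isGaussianWeights N
  have hN := node_pos s
  have key : ∀ p : ℝ[X], p.natDegree = 1 → (∀ x ∈ Set.Icc (-1 : ℝ) 1, 0 ≤ p.eval x) →
      0 < p.eval s.1 := by
    intro p hp hpos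
    have hp0 : p ≠ 0 := by rintro rfl; simp at hp
    have h := hw.quadrature_eq (p := nodeBasis s * (nodeBasis s * p)) (by
      rw [natDegree_mul (nodeBasis_ne_zero s) (mul_ne_zero (nodeBasis_ne_zero s) hp0),
        natDegree_mul (nodeBasis_ne_zero s) hp0, natDegree_nodeBasis, hp]
      omega)
    rw [quadrature_nodeBasis_mul, eval_mul, eval_nodeBasis, if_pos rfl, one_mul] at h
    have hI : 0 < integral (nodeBasis s * (nodeBasis s * p)) := by
      refine integral_pos (mul_ne_zero (nodeBasis_ne_zero s)
        (mul_ne_zero (nodeBasis_ne_zero s) hp0)) fun x hx => ?_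
      rw [eval_mul, eval_mul, ← mul_assoc]
      exact mul_nonneg (mul_self_nonneg _) (hpos x hx)
    rw [← h] at hI
    exact pos_of_mul_pos_left hI (hw.pos s).le
  constructor
  · have := key (X + C 1) (natDegree_X_add_C 1) (fun x hx => by simp; linarith [hx.1])
    simp at this; linarith
  · have := key (C 1 - X) (by rw [natDegree_sub, natDegree_X_sub_C]) (fun x hx => by
      simp; linarith [hx.2])
    simp at this; linarith

/-! ### Matrix coefficients of the symmetric powers of a unimodular matrix -/

/-- The coefficient of `Z^z` in a polynomial, for an integer `z`; zero for negative `z`. -/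
def zcoeff (P : Polynomial ℂ) (z : ℤ) : ℂ := if 0 ≤ z then P.coeff z.toNat else 0

lemma zcoeff_natCast (P : Polynomial ℂ) (z : ℕ) : zcoeff P z = P.coeff z := by
  simp [zcoeff]

lemma zcoeff_of_neg (P : Polynomial ℂ) {z : ℤ} (hz : z < 0) : zcoeff P z = 0 := by
  simp [zcoeff, hz]

lemma zcoeff_add (P P' : Polynomial ℂ) (z : ℤ) : zcoeff (P + P') z = zcoeff P z + zcoeff P' z := by
  unfold zcoeff; split_ifs <;> simp

lemma zcoeff_C_mul (c : ℂ) (P : Polynomial ℂ) (z : ℤ) :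
    zcoeff (Polynomial.C c * P) z = c * zcoeff P z := by
  unfold zcoeff; split_ifs <;> simp

lemma zcoeff_X_mul (P : Polynomial ℂ) (z : ℤ) :
    zcoeff (Polynomial.X * P) z = zcoeff P (z - 1) := by
  rcases lt_trichotomy z 0 with h | rfl | h
  · rw [zcoeff_of_neg _ h, zcoeff_of_neg _ (by omega)]
  · rw [zcoeff_of_neg _ (by omega : (0 : ℤ) - 1 < 0)]; simp [zcoeff]
  · obtain ⟨k, rfl⟩ : ∃ k : ℕ, z = k + 1 := ⟨(z - 1).toNat, by omega⟩
    rw [add_sub_cancel_right, zcoeff_natCast, ← Nat.cast_succ, zcoeff_natCast,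
      Polynomial.coeff_X_mul]

lemma zcoeff_derivative (P : Polynomial ℂ) (z : ℤ) :
    zcoeff (Polynomial.derivative P) z = (z + 1) * zcoeff P (z + 1) := by
  rcases lt_or_ge z 0 with h | h
  · rw [zcoeff_of_neg _ h]
    rcases lt_or_eq_of_le (by omega : z + 1 ≤ 0) with h1 | h1
    · rw [zcoeff_of_neg _ h1, mul_zero]
    · rw [show (z : ℂ) + 1 = 0 by exact_mod_cast h1, zero_mul]
  · obtain ⟨k, rfl⟩ := Int.eq_ofNat_of_zero_le h
    rw [zcoeff_natCast, ← Nat.cast_succ, zcoeff_natCast, Polynomial.coeff_derivative]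
    push_cast; ring

open Polynomial in
/-- The binary form `(g₂₂ - g₂₁ Z)ˡ (-g₁₂ + g₁₁ Z)ˡ'`, dehomogenized: the image of a basis vector
of the symmetric power of degree `l + l'` under the matrix `g`. -/
def symForm (g : Matrix (Fin 2) (Fin 2) ℂ) (l l' : ℕ) : ℂ[X] :=
  (C (g 1 1) - C (g 1 0) * X) ^ l * (-C (g 0 1) + C (g 0 0) * X) ^ l'

/-- The coefficient of `Z^z` in `symForm g l l'`. With `l = j + m_L`, `l' = j - m_L` and
`z = j - m_R` it is the Wigner function `D^j_{m_L m_R}` up to normalization. -/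
def symCoeff (g : Matrix (Fin 2) (Fin 2) ℂ) (l l' : ℕ) (z : ℤ) : ℂ := zcoeff (symForm g l l') z

lemma symCoeff_succ_left (g : Matrix (Fin 2) (Fin 2) ℂ) (l l' : ℕ) (z : ℤ) :
    symCoeff g (l + 1) l' z = g 1 1 * symCoeff g l l' z - g 1 0 * symCoeff g l l' (z - 1) := by
  have h : symForm g (l + 1) l' = Polynomial.C (g 1 1) * symForm g l l' +
      Polynomial.C (-g 1 0) * (Polynomial.X * symForm g l l') := by
    rw [symForm, symForm, Polynomial.C_neg]; ring
  rw [symCoeff, h, zcoeff_add, zcoeff_C_mul, zcoeff_C_mul, zcoeff_X_mul, symCoeff, symCoeff]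
  ring

lemma symCoeff_succ_right (g : Matrix (Fin 2) (Fin 2) ℂ) (l l' : ℕ) (z : ℤ) :
    symCoeff g l (l' + 1) z = -g 0 1 * symCoeff g l l' z + g 0 0 * symCoeff g l l' (z - 1) := by
  have h : symForm g l (l' + 1) = Polynomial.C (-g 0 1) * symForm g l l' +
      Polynomial.C (g 0 0) * (Polynomial.X * symForm g l l') := by
    rw [symForm, symForm, Polynomial.C_neg]; ring
  rw [symCoeff, h, zcoeff_add, zcoeff_C_mul, zcoeff_C_mul, zcoeff_X_mul, symCoeff, symCoeff]

lemma symCoeff_zero_zero (g : Matrix (Fin 2) (Fin 2) ℂ) (z : ℤ) :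
    symCoeff g 0 0 z = if z = 0 then 1 else 0 := by
  rcases lt_or_ge z 0 with h | h
  · rw [symCoeff, zcoeff_of_neg _ h, if_neg (by omega)]
  · obtain ⟨k, rfl⟩ := Int.eq_ofNat_of_zero_le h
    rw [symCoeff, zcoeff_natCast, symForm]
    simp [Polynomial.coeff_one]

lemma symCoeff_of_neg (g : Matrix (Fin 2) (Fin 2) ℂ) (l l' : ℕ) {z : ℤ} (hz : z < 0) :
    symCoeff g l l' z = 0 := zcoeff_of_neg _ hz

lemma symCoeff_of_lt (g : Matrix (Fin 2) (Fin 2) ℂ) (l l' : ℕ) {z : ℤ} (hz : (l + l' : ℤ) < z) :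
    symCoeff g l l' z = 0 := by
  induction l generalizing z with
  | zero =>
    induction l' generalizing z with
    | zero => rw [symCoeff_zero_zero, if_neg (by push_cast at hz; omega)]
    | succ l' ih =>
      push_cast at hz ih
      rw [symCoeff_succ_right, ih (by omega), ih (by omega)]; ring
  | succ l ih =>
    push_cast at hz
    rw [symCoeff_succ_left, ih (by omega), ih (by omega)]; ring

open Polynomial in
lemma symForm_factors {g : Matrix (Fin 2) (Fin 2) ℂ} (hg : g.det = 1) :
    C (g 0 0) * (C (g 1 1) - C (g 1 0) * X) + C (g 1 0) * (-C (g 0 1) + C (g 0 0) * X) = 1 := by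
  have h : g 0 0 * g 1 1 - g 0 1 * g 1 0 = 1 := by rw [← Matrix.det_fin_two, hg]
  have h' := congrArg C h
  simp only [C_sub, C_mul, C_1] at h'
  linear_combination h'

open Polynomial in
/-- The relation between the degrees `n + 1`, `n` and `n - 1`: the derivative of a product of powers
of the two linear factors, rewritten with the determinant relation `symForm_factors`. -/
lemma derivative_symForm_succ_left {g : Matrix (Fin 2) (Fin 2) ℂ} (hg : g.det = 1) (l l' : ℕ) :
    derivative (symForm g (l + 1) l') =
      C (-((l + l' + 1) * g 1 0)) * symForm g l l' + C (l' : ℂ) * symForm g l (l' - 1) := by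
  have h := symForm_factors hg
  rcases l' with _ | k
  · simp [symForm, derivative_pow]; ring
  · simp only [symForm, derivative_mul, derivative_pow, derivative_sub, derivative_add,
      derivative_neg, derivative_C, derivative_X, C_neg, C_mul, C_add, C_1, Nat.cast_add,
      Nat.cast_one, Nat.add_sub_cancel, map_natCast]
    linear_combination ((k : ℂ[X]) + 1) * (C (g 1 1) - C (g 1 0) * X) ^ l *
      (-C (g 0 1) + C (g 0 0) * X) ^ k * h

open Polynomial in
/-- The companion of `derivative_symForm_succ_left` for the other linear factor. -/
lemma derivative_symForm_succ_right {g : Matrix (Fin 2) (Fin 2) ℂ} (hg : g.det = 1) (l l' : ℕ) :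
    derivative (symForm g l (l' + 1)) =
      C ((l + l' + 1) * g 0 0) * symForm g l l' + C (-(l : ℂ)) * symForm g (l - 1) l' := by
  have h := symForm_factors hg
  rcases l with _ | k
  · simp [symForm, derivative_pow]; ring
  · simp only [symForm, derivative_mul, derivative_pow, derivative_sub, derivative_add,
      derivative_neg, derivative_C, derivative_X, C_neg, C_mul, C_add, C_1, Nat.cast_add,
      Nat.cast_one, Nat.add_sub_cancel, map_natCast]
    linear_combination -((k : ℂ[X]) + 1) * (C (g 1 1) - C (g 1 0) * X) ^ k *
      (-C (g 0 1) + C (g 0 0) * X) ^ l' * h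

/-- Multiplication by an entry of `g` couples the degree `l + l'` to the degrees `l + l' ± 1`. The
term with the truncated difference `l' - 1` (here) or `l - 1` (in the companions for the other
entries) has the factor `l'` or `l`, which vanishes where the difference is truncated. -/
lemma mul_symCoeff_one_zero {g : Matrix (Fin 2) (Fin 2) ℂ} (hg : g.det = 1) (l l' : ℕ) (z : ℤ) :
    (l + l' + 1) * (g 1 0 * symCoeff g l l' z) =
      -((z + 1) * symCoeff g (l + 1) l' (z + 1)) + l' * symCoeff g l (l' - 1) z := by
  have h := congrArg (fun P => zcoeff P z) (derivative_symForm_succ_left hg l l')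
  simp only [zcoeff_derivative, zcoeff_add, zcoeff_C_mul] at h
  simp only [symCoeff]
  linear_combination h

lemma mul_symCoeff_zero_zero {g : Matrix (Fin 2) (Fin 2) ℂ} (hg : g.det = 1) (l l' : ℕ) (z : ℤ) :
    (l + l' + 1) * (g 0 0 * symCoeff g l l' z) =
      (z + 1) * symCoeff g l (l' + 1) (z + 1) + l * symCoeff g (l - 1) l' z := by
  have h := congrArg (fun P => zcoeff P z) (derivative_symForm_succ_right hg l l')
  simp only [zcoeff_derivative, zcoeff_add, zcoeff_C_mul] at h
  simp only [symCoeff]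
  linear_combination -h

lemma mul_symCoeff_one_one {g : Matrix (Fin 2) (Fin 2) ℂ} (hg : g.det = 1) (l l' : ℕ) (z : ℤ) :
    (l + l' + 1) * (g 1 1 * symCoeff g l l' z) =
      (l + l' + 1 - z) * symCoeff g (l + 1) l' z + l' * symCoeff g l (l' - 1) (z - 1) := by
  have h := mul_symCoeff_one_zero hg l l' (z - 1)
  rw [sub_add_cancel] at h
  push_cast at h
  linear_combination h - (l + l' + 1 : ℂ) * symCoeff_succ_left g l l' z

lemma mul_symCoeff_zero_one {g : Matrix (Fin 2) (Fin 2) ℂ} (hg : g.det = 1) (l l' : ℕ) (z : ℤ) :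
    (l + l' + 1) * (g 0 1 * symCoeff g l l' z) =
      -((l + l' + 1 - z) * symCoeff g l (l' + 1) z) + l * symCoeff g (l - 1) l' (z - 1) := by
  have h := mul_symCoeff_zero_zero hg l l' (z - 1)
  rw [sub_add_cancel] at h
  push_cast at h
  linear_combination h + (l + l' + 1 : ℂ) * symCoeff_succ_right g l l' z

open Polynomial in
lemma coeff_C_add_C_mul_X_pow (a b : ℂ) (n k : ℕ) :
    ((C a + C b * X) ^ n : ℂ[X]).coeff k = n.choose k * b ^ k * a ^ (n - k) := by
  have : (C a + C b * X : ℂ[X]) = (X * C b + C a) := by ring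
  rw [this, add_pow, finsetSum_coeff, Finset.sum_eq_single k]
  · rw [mul_pow, ← C_pow, ← C_pow, ← C_eq_natCast]
    simp only [mul_assoc, ← C_mul, coeff_X_pow_mul', le_refl, if_true, Nat.sub_self, coeff_C_zero]
    ring
  · intro i _ hi
    rw [mul_pow, ← C_pow, ← C_pow, ← C_eq_natCast]
    simp only [mul_assoc, ← C_mul, coeff_X_pow_mul', coeff_C]
    split_ifs <;> first | rfl | omega
  · intro hk
    rw [Nat.choose_eq_zero_of_lt (by simpa using hk)]; simp

open Polynomial in
lemma symCoeff_natCast (g : Matrix (Fin 2) (Fin 2) ℂ) (l l' z : ℕ) : symCoeff g l l' z =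
    ∑ k ∈ Finset.range (z + 1), (l.choose k * (-g 1 0) ^ k * g 1 1 ^ (l - k)) *
      (l'.choose (z - k) * g 0 0 ^ (z - k) * (-g 0 1) ^ (l' - (z - k))) := by
  have hX : (C (g 1 1) - C (g 1 0) * X : ℂ[X]) = C (g 1 1) + C (-g 1 0) * X := by
    rw [C_neg]; ring
  rw [symCoeff, zcoeff_natCast, symForm, hX, ← C_neg, coeff_mul,
    Finset.Nat.sum_antidiagonal_eq_sum_range_succ_mk]
  simp only [coeff_C_add_C_mul_X_pow]

/-! ### Wigner functions as matrix coefficients -/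

lemma su2_zero_zero (θ φ ψ : ℝ) :
    su2 θ φ ψ 0 0 = Real.cos (θ / 2) * Complex.exp (-Complex.I * (φ + ψ) / 2) := rfl

lemma su2_zero_one (θ φ ψ : ℝ) :
    su2 θ φ ψ 0 1 = -Real.sin (θ / 2) * Complex.exp (-Complex.I * (φ - ψ) / 2) := rfl

lemma su2_one_zero (θ φ ψ : ℝ) :
    su2 θ φ ψ 1 0 = Real.sin (θ / 2) * Complex.exp (Complex.I * (φ - ψ) / 2) := rfl

lemma su2_one_one (θ φ ψ : ℝ) :
    su2 θ φ ψ 1 1 = Real.cos (θ / 2) * Complex.exp (Complex.I * (φ + ψ) / 2) := rfl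

lemma det_su2 (θ φ ψ : ℝ) : (su2 θ φ ψ).det = 1 := by
  rw [Matrix.det_fin_two]
  simp only [su2_zero_zero, su2_zero_one, su2_one_zero, su2_one_one]
  have h1 : Complex.exp (-Complex.I * (φ + ψ) / 2) * Complex.exp (Complex.I * (φ + ψ) / 2) = 1 := by
    rw [← Complex.exp_add, ← Complex.exp_zero]; congr 1; ring
  have h2 : Complex.exp (-Complex.I * (φ - ψ) / 2) * Complex.exp (Complex.I * (φ - ψ) / 2) = 1 := by
    rw [← Complex.exp_add, ← Complex.exp_zero]; congr 1; ring
  have h3 : (Real.cos (θ / 2) : ℂ) ^ 2 + (Real.sin (θ / 2) : ℂ) ^ 2 = 1 := by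
    exact_mod_cast Real.cos_sq_add_sin_sq (θ / 2)
  linear_combination (Real.cos (θ / 2) : ℂ) ^ 2 * h1 + (Real.sin (θ / 2) : ℂ) ^ 2 * h2 + h3

/-- The product `e^{i m_L φ} e^{i m_R ψ}` for `l = j + m_L`, `l' = j - m_L` and `z = j - m_R`. -/
def phase (φ ψ : ℝ) (l l' : ℕ) (z : ℤ) : ℂ :=
  Complex.exp (Complex.I * ((l - l') / 2) * φ) * Complex.exp (Complex.I * ((l + l') / 2 - z) * ψ)

/-- The angles `φ` and `ψ` enter the matrix coefficients only through a phase. -/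
lemma symCoeff_su2 (θ φ ψ : ℝ) (l l' : ℕ) (z : ℤ) : symCoeff (su2 θ φ ψ) l l' z =
    phase φ ψ l l' z * symCoeff (su2 θ 0 0) l l' z := by
  induction l generalizing z with
  | zero =>
    induction l' generalizing z with
    | zero =>
      rw [symCoeff_zero_zero, symCoeff_zero_zero]
      split_ifs with h
      · simp [h, phase]
      · simp
    | succ l' ih =>
      have h1 : Complex.exp (-Complex.I * (φ - ψ) / 2) * phase φ ψ 0 l' z =
          phase φ ψ 0 (l' + 1) z := by
        simp only [phase, ← Complex.exp_add]; congr 1; push_cast; ring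
      have h2 : Complex.exp (-Complex.I * (φ + ψ) / 2) * phase φ ψ 0 l' (z - 1) =
          phase φ ψ 0 (l' + 1) z := by
        simp only [phase, ← Complex.exp_add]; congr 1; push_cast; ring
      rw [symCoeff_succ_right, symCoeff_succ_right, ih, ih]
      simp only [su2_zero_zero, su2_zero_one, Complex.ofReal_zero, add_zero,
        sub_zero, mul_zero, zero_div, Complex.exp_zero]
      linear_combination (Real.sin (θ / 2) : ℂ) * symCoeff (su2 θ 0 0) 0 l' z * h1 +
        (Real.cos (θ / 2) : ℂ) * symCoeff (su2 θ 0 0) 0 l' (z - 1) * h2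
  | succ l ih =>
    have h1 : Complex.exp (Complex.I * (φ + ψ) / 2) * phase φ ψ l l' z =
        phase φ ψ (l + 1) l' z := by
      simp only [phase, ← Complex.exp_add]; congr 1; push_cast; ring
    have h2 : Complex.exp (Complex.I * (φ - ψ) / 2) * phase φ ψ l l' (z - 1) =
        phase φ ψ (l + 1) l' z := by
      simp only [phase, ← Complex.exp_add]; congr 1; push_cast; ring
    rw [symCoeff_succ_left, symCoeff_succ_left, ih, ih]
    simp only [su2_one_zero, su2_one_one, Complex.ofReal_zero, add_zero,
      sub_zero, mul_zero, zero_div, Complex.exp_zero]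
    linear_combination (Real.cos (θ / 2) : ℂ) * symCoeff (su2 θ 0 0) l l' z * h1 -
      (Real.sin (θ / 2) : ℂ) * symCoeff (su2 θ 0 0) l l' (z - 1) * h2

/-- With `φ = ψ = 0`, the matrix coefficient is a polynomial in `cos (θ / 2)` and `sin (θ / 2)`. -/
lemma symCoeff_su2_zero (θ : ℝ) (l l' z : ℕ) : symCoeff (su2 θ 0 0) l l' z =
    ((∑ k ∈ Finset.range (z + 1), (l.choose k * (-Real.sin (θ / 2)) ^ k *
      Real.cos (θ / 2) ^ (l - k)) * (l'.choose (z - k) * Real.cos (θ / 2) ^ (z - k) *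
        Real.sin (θ / 2) ^ (l' - (z - k))) : ℝ) : ℂ) := by
  rw [symCoeff_natCast]
  simp [su2]

lemma one_add_cos_div_two (θ : ℝ) : (1 + Real.cos θ) / 2 = Real.cos (θ / 2) ^ 2 := by
  rw [Real.cos_sq, mul_div_cancel₀ θ two_ne_zero]; ring

lemma one_sub_cos_div_two (θ : ℝ) : (1 - Real.cos θ) / 2 = Real.sin (θ / 2) ^ 2 := by
  have := one_add_cos_div_two θ
  have := Real.sin_sq_add_cos_sq (θ / 2)
  linarith

/-- The diagonal coefficient `l = l' = z` is a Legendre polynomial. -/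
lemma symCoeff_su2_zero_eq_legendre (θ : ℝ) (m : ℕ) :
    symCoeff (su2 θ 0 0) m m m = (((legendre m).eval (Real.cos θ) : ℝ) : ℂ) := by
  rw [symCoeff_su2_zero, eval_legendre]
  congr 1
  refine Finset.sum_congr rfl fun k hk => ?_
  have hk' : k ≤ m := Nat.lt_succ_iff.1 (Finset.mem_range.1 hk)
  rw [show (Real.cos θ - 1) / 2 = -Real.sin (θ / 2) ^ 2 by rw [← one_sub_cos_div_two]; ring,
    show (Real.cos θ + 1) / 2 = Real.cos (θ / 2) ^ 2 by rw [← one_add_cos_div_two]; ring,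
    Nat.choose_symm hk', Nat.sub_sub_self hk', neg_pow, neg_pow (Real.sin (θ / 2) ^ 2)]
  ring

namespace Triplet

variable {Q : ℕ} (t : Triplet Q)

/-- The natural number `j - m_L`. -/
def left' : ℕ := t.twoJ - t.left

/-- The natural number `j - m_R`. -/
def right' : ℕ := t.twoJ - t.right

lemma left_add_left' : t.left + t.left' = t.twoJ :=
  Nat.add_sub_cancel' (Nat.lt_succ_iff.1 t.2.1.2)

lemma right_add_right' : t.right + t.right' = t.twoJ :=
  Nat.add_sub_cancel' (Nat.lt_succ_iff.1 t.2.2.2)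

lemma twoJ_le : t.twoJ ≤ Q := Nat.lt_succ_iff.1 t.1.2

lemma mL_eq : t.mL = ((t.left : ℝ) - t.left') / 2 := by
  rw [mL, j, ← left_add_left']; push_cast; ring

lemma mR_eq : t.mR = ((t.right : ℝ) - t.right') / 2 := by
  rw [mR, j, ← right_add_right']; push_cast; ring

lemma j_eq : t.j = ((t.left : ℝ) + t.left') / 2 := by
  rw [j, ← left_add_left']; push_cast; ring

end Triplet

/-- In the interior `0 < θ < π`, the Wigner `d`-function is the matrix coefficient up to its
normalization. The Jacobi polynomial may have negative parameters; its terms that would give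
negative powers of `sin (θ / 2)` or `cos (θ / 2)` have zero binomial coefficients. -/
lemma wignerd_eq {Q : ℕ} (t : Triplet Q) {θ : ℝ} (hs : 0 < Real.sin (θ / 2))
    (hc : 0 < Real.cos (θ / 2)) : (wignerd t θ : ℂ) =
      (Real.sqrt ((t.right.factorial * t.right'.factorial) /
        (t.left.factorial * t.left'.factorial)) : ℂ) *
          symCoeff (su2 θ 0 0) t.left t.left' t.right' := by
  have hl := t.left_add_left'
  have hr := t.right_add_right'
  rw [symCoeff_su2_zero, ← Complex.ofReal_mul, wignerd]
  change (((Real.sqrt ((t.right.factorial * t.right'.factorial) /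
        (t.left.factorial * t.left'.factorial)) * _ * _ *
    jacobi t.right' _ _ _ : ℝ)) : ℂ) = _
  rw [mul_assoc, mul_assoc]
  congr 2
  set s := Real.sin (θ / 2)
  set c := Real.cos (θ / 2)
  have hs' : ((1 - Real.cos θ) / 2) ^ ((t.mR - t.mL) / 2) = s ^ ((t.right : ℤ) - t.left) := by
    rw [one_sub_cos_div_two, ← Real.rpow_natCast, ← Real.rpow_mul hs.le, ← Real.rpow_intCast]
    congr 1; rw [Triplet.mR, Triplet.mL]; push_cast; ring
  have hc' : ((1 + Real.cos θ) / 2) ^ ((t.mR + t.mL) / 2) =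
      c ^ ((t.right : ℤ) + t.left - t.twoJ) := by
    rw [one_add_cos_div_two, ← Real.rpow_natCast, ← Real.rpow_mul hc.le, ← Real.rpow_intCast]
    congr 1; rw [Triplet.mR, Triplet.mL, Triplet.j]; push_cast; ring
  rw [hs', hc', jacobi, Finset.mul_sum, Finset.mul_sum]
  refine Finset.sum_congr rfl fun k hk => ?_
  have hk' : k ≤ t.right' := Nat.lt_succ_iff.1 (Finset.mem_range.1 hk)
  rw [show (t.right' : ℤ) + ((t.right : ℤ) - t.left) = (t.left' : ℕ) by omega,
    show (t.right' : ℤ) + ((t.right : ℤ) + t.left - t.twoJ) = (t.left : ℕ) by omega,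
    Ring.choose_natCast, Ring.choose_natCast,
    show (Real.cos θ - 1) / 2 = -s ^ 2 by rw [← one_sub_cos_div_two]; ring,
    show (Real.cos θ + 1) / 2 = c ^ 2 by rw [← one_add_cos_div_two]; ring]
  by_cases h1 : t.left < k
  · simp [Nat.choose_eq_zero_of_lt h1]
  by_cases h2 : t.left' < t.right' - k
  · simp [Nat.choose_eq_zero_of_lt h2]
  have e1 : s ^ ((t.right : ℤ) - t.left) * s ^ (2 * k) =
      s ^ k * s ^ (t.left' - (t.right' - k)) := by
    rw [← zpow_natCast, ← zpow_natCast, ← zpow_natCast, ← zpow_add₀ hs.ne', ← zpow_add₀ hs.ne']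
    congr 1; omega
  have e2 : c ^ ((t.right : ℤ) + t.left - t.twoJ) * c ^ (2 * (t.right' - k)) =
      c ^ (t.left - k) * c ^ (t.right' - k) := by
    rw [← zpow_natCast, ← zpow_natCast, ← zpow_natCast, ← zpow_add₀ hc.ne', ← zpow_add₀ hc.ne']
    congr 1; omega
  rw [pow_mul] at e1 e2
  rw [neg_pow (s ^ 2), neg_pow s]
  push_cast
  linear_combination (t.left'.choose (t.right' - k) * t.left.choose k * (-1 : ℝ) ^ k) *
    (c ^ ((t.right : ℤ) + t.left - t.twoJ) * (c ^ 2) ^ (t.right' - k) * e1 +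
      s ^ k * s ^ (t.left' - (t.right' - k)) * e2)

lemma wignerD_eq {Q : ℕ} (t : Triplet Q) {θ : ℝ} (hs : 0 < Real.sin (θ / 2))
    (hc : 0 < Real.cos (θ / 2)) (φ ψ : ℝ) : wignerD t θ φ ψ =
      (Real.sqrt ((t.right.factorial * t.right'.factorial) /
        (t.left.factorial * t.left'.factorial)) : ℂ) *
          symCoeff (su2 θ φ ψ) t.left t.left' t.right' := by
  rw [wignerD, wignerd_eq t hs hc, symCoeff_su2 θ φ ψ, phase, t.mL_eq, t.mR_eq]
  have h : ((t.left : ℂ) + t.left') = t.right + t.right' := by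
    exact_mod_cast t.left_add_left'.trans t.right_add_right'.symm
  rw [h, show ((t.right + t.right' : ℂ) / 2 - ((t.right' : ℤ) : ℂ)) = (t.right - t.right') / 2 by
    push_cast; ring]
  push_cast
  ring

/-! ### The discrete inner product of the matrix coefficients -/

lemma star_su2_one_one (θ φ ψ : ℝ) : star (su2 θ φ ψ 1 1) = su2 θ φ ψ 0 0 := by
  simp only [su2_zero_zero, su2_one_one, Complex.star_def, map_mul, Complex.conj_ofReal,
    ← Complex.exp_conj, map_div₀, map_add, Complex.conj_I, map_ofNat]

lemma star_su2_one_zero (θ φ ψ : ℝ) : star (su2 θ φ ψ 1 0) = -su2 θ φ ψ 0 1 := by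
  simp only [su2_zero_one, su2_one_zero, Complex.star_def, map_mul, Complex.conj_ofReal,
    ← Complex.exp_conj, map_div₀, map_sub, Complex.conj_I, map_ofNat, neg_mul, neg_neg]

lemma star_su2_zero_zero (θ φ ψ : ℝ) : star (su2 θ φ ψ 0 0) = su2 θ φ ψ 1 1 := by
  rw [← star_su2_one_one, star_star]

lemma star_su2_zero_one (θ φ ψ : ℝ) : star (su2 θ φ ψ 0 1) = -su2 θ φ ψ 1 0 := by
  rw [← neg_eq_iff_eq_neg, ← star_neg, ← star_su2_one_zero, star_star]

/-- The element of SU(2) at a point of the partitioning. -/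
def pointSU {Nθ Nφ Nψ : ℕ} (p : Point Nθ Nφ Nψ) : Matrix (Fin 2) (Fin 2) ℂ :=
  su2 (nodeAngle p.1) (circleAngle p.2.1) (circleAngle p.2.2)

lemma det_pointSU {Nθ Nφ Nψ : ℕ} (p : Point Nθ Nφ Nψ) : (pointSU p).det = 1 := det_su2 _ _ _

lemma link_mulVec {Nθ Nφ Nψ : ℕ} (c d : Fin 2) (v : Point Nθ Nφ Nψ → ℂ) (p : Point Nθ Nφ Nψ) :
    (link Nθ Nφ Nψ c d *ᵥ v) p = pointSU p c d * v p := by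
  rw [link, Matrix.mulVec_diagonal]; rfl

/-- The matrix coefficients `symCoeff`, sampled at the points and multiplied by the square root of
the quadrature weight. -/
def symVec {Nθ : ℕ} (Nφ Nψ : ℕ) (w : Node Nθ → ℝ) (l l' : ℕ) (z : ℤ) : Point Nθ Nφ Nψ → ℂ :=
  fun p => (Real.sqrt (w p.1 / ((Nφ : ℝ) * (Nψ : ℝ))) : ℂ) * symCoeff (pointSU p) l l' z

section Link

variable {Nθ : ℕ} (Nφ Nψ : ℕ) (w : Node Nθ → ℝ) (l l' : ℕ) (z : ℤ)

lemma cast_add_add_one_ne_zero (l l' : ℕ) : ((l : ℂ) + l' + 1) ≠ 0 := by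
  exact_mod_cast Nat.succ_ne_zero (l + l')

lemma symVec_succ_left : symVec Nφ Nψ w (l + 1) l' z =
    link Nθ Nφ Nψ 1 1 *ᵥ symVec Nφ Nψ w l l' z -
      link Nθ Nφ Nψ 1 0 *ᵥ symVec Nφ Nψ w l l' (z - 1) := by
  funext p
  simp only [Pi.sub_apply, link_mulVec, symVec, symCoeff_succ_left]
  ring

lemma symVec_succ_right : symVec Nφ Nψ w l (l' + 1) z =
    link Nθ Nφ Nψ 0 0 *ᵥ symVec Nφ Nψ w l l' (z - 1) -
      link Nθ Nφ Nψ 0 1 *ᵥ symVec Nφ Nψ w l l' z := by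
  funext p
  simp only [Pi.sub_apply, link_mulVec, symVec, symCoeff_succ_right]
  ring

lemma link_zero_zero_mulVec_symVec : link Nθ Nφ Nψ 0 0 *ᵥ symVec Nφ Nψ w l l' z =
    ((l : ℂ) + l' + 1)⁻¹ • ((z + 1 : ℂ) • symVec Nφ Nψ w l (l' + 1) (z + 1) +
      (l : ℂ) • symVec Nφ Nψ w (l - 1) l' z) := by
  funext p
  rw [link_mulVec, Pi.smul_apply, smul_eq_mul,
    eq_inv_mul_iff_mul_eq₀ (cast_add_add_one_ne_zero l l')]
  simp only [Pi.add_apply, Pi.smul_apply, smul_eq_mul, symVec]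
  linear_combination (Real.sqrt (w p.1 / ((Nφ : ℝ) * (Nψ : ℝ))) : ℂ) *
    mul_symCoeff_zero_zero (det_pointSU p) l l' z

lemma link_zero_one_mulVec_symVec : link Nθ Nφ Nψ 0 1 *ᵥ symVec Nφ Nψ w l l' z =
    ((l : ℂ) + l' + 1)⁻¹ • (-(l + l' + 1 - z : ℂ) • symVec Nφ Nψ w l (l' + 1) z +
      (l : ℂ) • symVec Nφ Nψ w (l - 1) l' (z - 1)) := by
  funext p
  rw [link_mulVec, Pi.smul_apply, smul_eq_mul,
    eq_inv_mul_iff_mul_eq₀ (cast_add_add_one_ne_zero l l')]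
  simp only [Pi.add_apply, Pi.smul_apply, smul_eq_mul, symVec]
  linear_combination (Real.sqrt (w p.1 / ((Nφ : ℝ) * (Nψ : ℝ))) : ℂ) *
    mul_symCoeff_zero_one (det_pointSU p) l l' z

lemma link_one_zero_mulVec_symVec : link Nθ Nφ Nψ 1 0 *ᵥ symVec Nφ Nψ w l l' z =
    ((l : ℂ) + l' + 1)⁻¹ • (-(z + 1 : ℂ) • symVec Nφ Nψ w (l + 1) l' (z + 1) +
      (l' : ℂ) • symVec Nφ Nψ w l (l' - 1) z) := by
  funext p
  rw [link_mulVec, Pi.smul_apply, smul_eq_mul,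
    eq_inv_mul_iff_mul_eq₀ (cast_add_add_one_ne_zero l l')]
  simp only [Pi.add_apply, Pi.smul_apply, smul_eq_mul, symVec]
  linear_combination (Real.sqrt (w p.1 / ((Nφ : ℝ) * (Nψ : ℝ))) : ℂ) *
    mul_symCoeff_one_zero (det_pointSU p) l l' z

lemma link_one_one_mulVec_symVec : link Nθ Nφ Nψ 1 1 *ᵥ symVec Nφ Nψ w l l' z =
    ((l : ℂ) + l' + 1)⁻¹ • ((l + l' + 1 - z : ℂ) • symVec Nφ Nψ w (l + 1) l' z +
      (l' : ℂ) • symVec Nφ Nψ w l (l' - 1) (z - 1)) := by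
  funext p
  rw [link_mulVec, Pi.smul_apply, smul_eq_mul,
    eq_inv_mul_iff_mul_eq₀ (cast_add_add_one_ne_zero l l')]
  simp only [Pi.add_apply, Pi.smul_apply, smul_eq_mul, symVec]
  linear_combination (Real.sqrt (w p.1 / ((Nφ : ℝ) * (Nψ : ℝ))) : ℂ) *
    mul_symCoeff_one_one (det_pointSU p) l l' z

end Link

lemma star_link_mulVec_dotProduct {Nθ Nφ Nψ : ℕ} {c d c' d' : Fin 2} {ε : ℂ}
    (h : ∀ p : Point Nθ Nφ Nψ, star (pointSU p c d) = ε * pointSU p c' d')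
    (u v : Point Nθ Nφ Nψ → ℂ) :
    star (link Nθ Nφ Nψ c d *ᵥ u) ⬝ᵥ v = ε * (star u ⬝ᵥ link Nθ Nφ Nψ c' d' *ᵥ v) := by
  simp only [dotProduct, Finset.mul_sum, Pi.star_apply, link_mulVec, star_mul, h]
  exact Finset.sum_congr rfl fun p _ => by ring

/-- The binomial coefficients `C(n, z)` for an integer `z`. -/
def binom (n : ℕ) (z : ℤ) : ℂ := zcoeff ((1 + Polynomial.X) ^ n) z

lemma binom_natCast (n z : ℕ) : binom n z = n.choose z := by
  rw [binom, zcoeff_natCast, Polynomial.coeff_one_add_X_pow]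

lemma binom_zero (z : ℤ) : binom 0 z = if z = 0 then 1 else 0 := by
  have := symCoeff_zero_zero 1 z
  simpa [symCoeff, symForm, binom] using this

lemma binom_succ (n : ℕ) (z : ℤ) : binom (n + 1) z = binom n z + binom n (z - 1) := by
  rw [binom, pow_succ', add_mul, one_mul, zcoeff_add, zcoeff_X_mul]; rfl

lemma mul_binom_succ (n : ℕ) (z : ℤ) : z * binom (n + 1) z = (n + 1) * binom n (z - 1) := by
  have h := zcoeff_derivative ((1 + Polynomial.X) ^ (n + 1)) (z - 1)
  have h' : Polynomial.derivative ((1 + Polynomial.X : Polynomial ℂ) ^ (n + 1)) =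
      Polynomial.C ((n : ℂ) + 1) * (1 + Polynomial.X) ^ n := by
    simp [Polynomial.derivative_pow]
  rw [h', zcoeff_C_mul, sub_add_cancel] at h
  push_cast at h
  rw [binom, binom, h]; ring

lemma sub_mul_binom_succ (n : ℕ) (z : ℤ) :
    (n + 1 - z) * binom (n + 1) z = (n + 1) * binom n z := by
  linear_combination (n + 1 : ℂ) * binom_succ n z - mul_binom_succ n z

/-- Since `circleAngle b` runs over multiples of `4 π / N`, half-integer phases `k / 2` with
`|k| < N` are resolved. -/
lemma sum_exp_circleAngle {N : ℕ} {k : ℤ} (hk : |k| < N) :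
    ∑ b : Fin N, Complex.exp (Complex.I * (k / 2) * circleAngle b) =
      if k = 0 then (N : ℂ) else 0 := by
  split_ifs with h
  · simp [h]
  have hN : (N : ℂ) ≠ 0 := by
    rintro hN
    have : N = 0 := by exact_mod_cast hN
    subst this
    exact absurd hk (by simp)
  set ζ : ℂ := Complex.exp (2 * Real.pi * Complex.I * (k / N)) with hζ
  have h1 : ζ ≠ 1 := by
    intro h1
    obtain ⟨m, hm⟩ := Complex.exp_eq_one_iff.1 h1
    have hpi : (2 * Real.pi * Complex.I : ℂ) ≠ 0 := Complex.two_pi_I_ne_zero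
    rw [mul_comm (m : ℂ)] at hm
    have h2 := mul_left_cancel₀ hpi hm
    rw [div_eq_iff hN] at h2
    have h3 : k = m * N := by exact_mod_cast h2
    exact h (Int.eq_zero_of_abs_lt_dvd ⟨m, by rw [h3, mul_comm]⟩ hk)
  have h2 : ζ ^ N = 1 := by
    rw [hζ, ← Complex.exp_nat_mul, Complex.exp_eq_one_iff]
    exact ⟨k, by field_simp⟩
  have h3 : ∀ b : Fin N, Complex.exp (Complex.I * (k / 2) * circleAngle b) = ζ * ζ ^ (b : ℕ) := by
    intro b
    rw [← pow_succ', hζ, ← Complex.exp_nat_mul]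
    congr 1
    rw [circleAngle]; push_cast; field_simp; ring
  rw [Finset.sum_congr rfl fun b _ => h3 b, ← Finset.mul_sum,
    Fin.sum_univ_eq_sum_range (fun i => ζ ^ i) N, geom_sum_eq h1, h2]
  simp

lemma cos_nodeAngle {N : ℕ} (s : Node N) : Real.cos (nodeAngle s) = s.1 :=
  Real.cos_arccos (node_mem_Ioo s).1.le (node_mem_Ioo s).2.le

/-- The invariant integral of a matrix coefficient of spin at most `Q` is computed exactly by the
points: the equidistant angles annihilate all nontrivial phases, and what is left is a Legendre
polynomial integrated by Gaussian quadrature. -/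
lemma sum_weight_mul_symCoeff (hθ : Q < 2 * Nθ) (hφ : 2 * Q < Nφ) (hψ : 2 * Q < Nψ)
    (hw : IsGaussianWeights Nθ w) {m m' : ℕ} (hm : m + m' ≤ 2 * Q) (y : ℤ) :
    ∑ p : Point Nθ Nφ Nψ, ((w p.1 / ((Nφ : ℝ) * (Nψ : ℝ)) : ℝ) : ℂ) * symCoeff (pointSU p) m m' y =
      if m = 0 ∧ m' = 0 ∧ y = 0 then 2 else 0 := by
  by_cases hy : 0 ≤ y ∧ y ≤ m + m'
  swap
  · have h0 : ∀ g, symCoeff g m m' y = 0 := fun g => by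
      rcases not_and_or.1 hy with h | h
      · exact symCoeff_of_neg g m m' (by omega)
      · exact symCoeff_of_lt g m m' (by omega)
    rw [if_neg (by omega)]
    simp [h0]
  have hφ0 : (Nφ : ℂ) ≠ 0 := by exact_mod_cast (by omega : Nφ ≠ 0)
  have hψ0 : (Nψ : ℂ) ≠ 0 := by exact_mod_cast (by omega : Nψ ≠ 0)
  have h1 := sum_exp_circleAngle (N := Nφ) (k := (m : ℤ) - m')
    (abs_lt.2 ⟨by omega, by omega⟩)
  have h2 := sum_exp_circleAngle (N := Nψ) (k := (m : ℤ) + m' - 2 * y)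
    (abs_lt.2 ⟨by omega, by omega⟩)
  have hfac : ∑ p : Point Nθ Nφ Nψ, ((w p.1 / ((Nφ : ℝ) * (Nψ : ℝ)) : ℝ) : ℂ) *
      symCoeff (pointSU p) m m' y =
      (Nφ * Nψ : ℂ)⁻¹ * (∑ s : Node Nθ, (w s : ℂ) * symCoeff (su2 (nodeAngle s) 0 0) m m' y) *
        ((∑ b : Fin Nφ, Complex.exp (Complex.I * (((m : ℤ) - m' : ℤ) / 2) * circleAngle b)) *
        (∑ c : Fin Nψ,
          Complex.exp (Complex.I * (((m : ℤ) + m' - 2 * y : ℤ) / 2) * circleAngle c))) := by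
    rw [Fintype.sum_prod_type, Finset.mul_sum, Finset.sum_mul]
    refine Finset.sum_congr rfl fun s _ => ?_
    rw [Fintype.sum_prod_type, Finset.sum_mul_sum, Finset.mul_sum]
    refine Finset.sum_congr rfl fun b _ => ?_
    rw [Finset.mul_sum]
    refine Finset.sum_congr rfl fun c _ => ?_
    rw [pointSU, symCoeff_su2, phase]
    rw [show (Complex.I * (((m : ℤ) + m' - 2 * y : ℤ) / 2) * circleAngle c) =
      Complex.I * (((m : ℂ) + m') / 2 - y) * circleAngle c by push_cast; ring]
    push_cast
    field_simp
  rw [hfac, h1, h2]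
  by_cases hmm : m = m' ∧ y = m
  · obtain ⟨rfl, rfl⟩ := hmm
    rw [if_pos (by omega), if_pos (by omega)]
    have h3 := hw.quadrature_eq (p := legendre m) (by rw [natDegree_legendre]; omega)
    rw [quadrature_apply, integral_legendre] at h3
    have h4 : ∑ s : Node Nθ, (w s : ℂ) * symCoeff (su2 (nodeAngle s) 0 0) m m m =
        ((if m = 0 then 2 else 0 : ℝ) : ℂ) := by
      rw [← h3, Complex.ofReal_sum]
      refine Finset.sum_congr rfl fun s _ => ?_
      rw [symCoeff_su2_zero_eq_legendre, cos_nodeAngle]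
      push_cast; ring
    rw [h4]
    by_cases h0 : m = 0
    · rw [if_pos h0, if_pos (by omega)]; push_cast; field_simp
    · rw [if_neg h0, if_neg (by omega)]; simp
  · rw [if_neg (by omega : ¬(m = 0 ∧ m' = 0 ∧ y = 0))]
    by_cases h5 : m = m'
    · rw [if_neg (by omega : ¬((m : ℤ) + m' - 2 * y = 0))]; simp
    · rw [if_neg (by omega : ¬((m : ℤ) - m' = 0))]; simp

/-- The squared norm of `symVec Nφ Nψ w l l' z`. -/
def normSqSymVec (l l' : ℕ) (z : ℤ) : ℂ :=
  2 * l.factorial * l'.factorial / (l + l' + 1).factorial * binom (l + l') z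

lemma normSqSymVec_succ_left (l l' : ℕ) (z : ℤ) :
    (l + l' + 2) * normSqSymVec (l + 1) l' z =
      (l + 1) * (normSqSymVec l l' z + normSqSymVec l l' (z - 1)) := by
  have h0 : ((l + l' + 1).factorial : ℂ) ≠ 0 := by exact_mod_cast Nat.factorial_ne_zero _
  have h1 : ((l + 1 + l' + 1).factorial : ℂ) = (l + l' + 2) * (l + l' + 1).factorial := by
    rw [show l + 1 + l' + 1 = (l + l' + 1) + 1 by ring, Nat.factorial_succ]; push_cast; ring
  have h2 : ((l : ℂ) + l' + 2) ≠ 0 := by exact_mod_cast Nat.succ_ne_zero (l + l' + 1)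
  simp only [normSqSymVec]
  rw [h1, show l + 1 + l' = l + l' + 1 by ring, binom_succ, Nat.factorial_succ l]
  push_cast
  field_simp

lemma normSqSymVec_comm (l l' : ℕ) (z : ℤ) : normSqSymVec l l' z = normSqSymVec l' l z := by
  rw [normSqSymVec, normSqSymVec, add_comm l l']; ring

lemma normSqSymVec_succ_right (l l' : ℕ) (z : ℤ) :
    (l + l' + 2) * normSqSymVec l (l' + 1) z =
      (l' + 1) * (normSqSymVec l l' z + normSqSymVec l l' (z - 1)) := by
  rw [normSqSymVec_comm, normSqSymVec_comm l, normSqSymVec_comm l,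
    ← normSqSymVec_succ_left]; ring

/-- Makes the contributions to an inner product of vectors of adjacent spins cancel. -/
lemma mul_normSqSymVec {l l' n : ℕ} (h : l + l' = n + 1) (z : ℤ) :
    z * normSqSymVec l l' z = (n + 2 - z) * normSqSymVec l l' (z - 1) := by
  have h1 := mul_binom_succ n z
  have h2 := sub_mul_binom_succ n (z - 1)
  push_cast at h2
  rw [normSqSymVec, normSqSymVec, h]
  linear_combination (2 * l.factorial * l'.factorial / (n + 1 + 1).factorial : ℂ) * (h1 - h2)

section Recursion

variable {Nθ : ℕ} (Nφ Nψ : ℕ) (w : Node Nθ → ℝ)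

/-- The discrete inner product of two sampled matrix coefficients. -/
def symInner (l l' : ℕ) (z : ℤ) (m m' : ℕ) (y : ℤ) : ℂ :=
  star (symVec Nφ Nψ w l l' z) ⬝ᵥ symVec Nφ Nψ w m m' y

/-- Unitarity moves a linear factor from the left to the right vector, where it is expanded in the
neighbouring spins. -/
lemma symInner_succ_left (l l' : ℕ) (z : ℤ) (m m' : ℕ) (y : ℤ) :
    symInner Nφ Nψ w (l + 1) l' z m m' y = ((m : ℂ) + m' + 1)⁻¹ *
      ((y + 1) * symInner Nφ Nψ w l l' z m (m' + 1) (y + 1) +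
        m * symInner Nφ Nψ w l l' z (m - 1) m' y -
        (m + m' + 1 - y) * symInner Nφ Nψ w l l' (z - 1) m (m' + 1) y +
        m * symInner Nφ Nψ w l l' (z - 1) (m - 1) m' (y - 1)) := by
  simp only [symInner]
  rw [symVec_succ_left, star_sub, sub_dotProduct,
    star_link_mulVec_dotProduct (c' := 0) (d' := 0) (ε := 1)
      (fun p => by rw [one_mul]; exact star_su2_one_one _ _ _),
    star_link_mulVec_dotProduct (c := 1) (d := 0) (c' := 0) (d' := 1) (ε := -1)
      (fun p => by rw [neg_one_mul]; exact star_su2_one_zero _ _ _),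
    link_zero_zero_mulVec_symVec, link_zero_one_mulVec_symVec]
  simp only [dotProduct_add, dotProduct_smul, smul_eq_mul]
  ring

lemma symInner_succ_right (l l' : ℕ) (z : ℤ) (m m' : ℕ) (y : ℤ) :
    symInner Nφ Nψ w l (l' + 1) z m m' y = ((m : ℂ) + m' + 1)⁻¹ *
      (-((y + 1) * symInner Nφ Nψ w l l' z (m + 1) m' (y + 1)) +
        m' * symInner Nφ Nψ w l l' z m (m' - 1) y +
        (m + m' + 1 - y) * symInner Nφ Nψ w l l' (z - 1) (m + 1) m' y +
        m' * symInner Nφ Nψ w l l' (z - 1) m (m' - 1) (y - 1)) := by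
  simp only [symInner]
  rw [symVec_succ_right, star_sub, sub_dotProduct,
    star_link_mulVec_dotProduct (c' := 1) (d' := 1) (ε := 1)
      (fun p => by rw [one_mul]; exact star_su2_zero_zero _ _ _),
    star_link_mulVec_dotProduct (c := 0) (d := 1) (c' := 1) (d' := 0) (ε := -1)
      (fun p => by rw [neg_one_mul]; exact star_su2_zero_one _ _ _),
    link_one_one_mulVec_symVec, link_one_zero_mulVec_symVec]
  simp only [dotProduct_add, dotProduct_smul, smul_eq_mul]
  ring

end Recursion

lemma symInner_zero_zero {Q Nθ Nφ Nψ : ℕ} (hθ : Q < 2 * Nθ) (hφ : 2 * Q < Nφ) (hψ : 2 * Q < Nψ)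
    {w : Node Nθ → ℝ} (hw : IsGaussianWeights Nθ w) {m m' : ℕ} (hm : m + m' ≤ 2 * Q) (z y : ℤ) :
    symInner Nφ Nψ w 0 0 z m m' y =
      if 0 = m ∧ 0 = m' ∧ z = y then normSqSymVec 0 0 z else 0 := by
  simp only [symInner, dotProduct, symVec, Pi.star_apply, symCoeff_zero_zero]
  by_cases hz : z = 0
  · subst hz
    have h := sum_weight_mul_symCoeff hθ hφ hψ hw hm y
    have h1 : normSqSymVec 0 0 0 = 2 := by simp [normSqSymVec, binom_zero]
    rw [h1, if_congr (by omega : (0 = m ∧ 0 = m' ∧ (0 : ℤ) = y) ↔ (m = 0 ∧ m' = 0 ∧ y = 0)) rfl rfl,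
      ← h]
    refine Finset.sum_congr rfl fun p _ => ?_
    have h2 : 0 ≤ w p.1 / ((Nφ : ℝ) * (Nψ : ℝ)) := div_nonneg (hw.pos _).le (by positivity)
    rw [if_pos rfl, mul_one, Complex.star_def, Complex.conj_ofReal, ← mul_assoc,
      ← Complex.ofReal_mul, Real.mul_self_sqrt h2]
  · have h1 : normSqSymVec 0 0 z = 0 := by simp [normSqSymVec, binom_zero, hz]
    simp [hz, h1]

/-- Discrete orthogonality. Induction on the degree of the left vector: each linear factor moved to
the right vector changes its spin by one half, and a left vector of spin zero leaves an invariant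
integral. -/
lemma symInner_eq {Q Nθ Nφ Nψ : ℕ} (hθ : Q < 2 * Nθ) (hφ : 2 * Q < Nφ) (hψ : 2 * Q < Nψ)
    {w : Node Nθ → ℝ} (hw : IsGaussianWeights Nθ w) {l l' m m' : ℕ}
    (hm : l + l' + (m + m') ≤ 2 * Q) (z y : ℤ) :
    symInner Nφ Nψ w l l' z m m' y =
      if l = m ∧ l' = m' ∧ z = y then normSqSymVec l l' z else 0 := by
  induction l generalizing z m m' y with
  | zero =>
    induction l' generalizing z m m' y with
    | zero => exact symInner_zero_zero hθ hφ hψ hw (by omega) z y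
    | succ l' ih =>
      have hn := cast_add_add_one_ne_zero m m'
      rw [symInner_succ_right, ih (by omega), ih (by omega), ih (by omega), ih (by omega),
        inv_mul_eq_iff_eq_mul₀ hn]
      rcases m' with _ | m'
      · simp
      · by_cases h : 0 = m ∧ l' = m' ∧ z = y
        · obtain ⟨rfl, rfl, rfl⟩ := h
          have := normSqSymVec_succ_right 0 l' z
          simp
          push_cast at this
          linear_combination -this
        · rw [if_neg (by omega), if_neg (by omega), if_neg (by omega), if_neg (by omega),
            if_neg (by omega)]
          ring
  | succ l ih =>
    have hn := cast_add_add_one_ne_zero m m'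
    rw [symInner_succ_left, ih (by omega), ih (by omega), ih (by omega), ih (by omega),
      inv_mul_eq_iff_eq_mul₀ hn]
    by_cases ha : l = m ∧ l' = m' + 1 ∧ z = y + 1
    · -- here the right vector is half a spin below the left one
      obtain ⟨rfl, rfl, rfl⟩ := ha
      have := mul_normSqSymVec (l := l) (l' := m' + 1) (n := l + m') (by ring) (y + 1)
      push_cast at this
      rw [if_pos ⟨rfl, rfl, rfl⟩, if_neg (by omega), if_pos (by omega), if_neg (by omega),
        if_neg (by omega)]
      rw [add_sub_cancel_right] at this ⊢
      linear_combination this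
    rw [if_neg ha, if_neg (by omega : ¬(l = m ∧ l' = m' + 1 ∧ z - 1 = y))]
    rcases m with _ | m
    · simp
    · by_cases h : l = m ∧ l' = m' ∧ z = y
      · obtain ⟨rfl, rfl, rfl⟩ := h
        have := normSqSymVec_succ_left l l' z
        simp
        linear_combination -this
      · rw [if_neg (by omega), if_neg (by omega), if_neg (by omega)]
        ring

/-! ### The columns of the discrete Jacobi transform -/

/-- The factor between the columns of the discrete Jacobi transform and the sampled matrix
coefficients, for `l = j + m_L`, `l' = j - m_L`, `r = j + m_R`, `r' = j - m_R`. -/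
def colNorm (l l' r r' : ℕ) : ℝ :=
  Real.sqrt (((l : ℝ) + l' + 1) / 2) *
    Real.sqrt ((r.factorial * r'.factorial) / (l.factorial * l'.factorial))

lemma colNorm_pos (l l' r r' : ℕ) : 0 < colNorm l l' r r' := by
  unfold colNorm; positivity

lemma col_djt {Q Nθ : ℕ} (Nφ Nψ : ℕ) (w : Node Nθ → ℝ) (t : Triplet Q) :
    (djt Q Nφ Nψ w).col t = (colNorm t.left t.left' t.right t.right' : ℂ) •
      symVec Nφ Nψ w t.left t.left' t.right' := by
  funext p
  have h := node_mem_Ioo p.1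
  have h1 : 0 < nodeAngle p.1 := Real.arccos_pos.2 h.2
  have h2 : nodeAngle p.1 < Real.pi := Real.arccos_lt_pi.2 h.1
  have hs : 0 < Real.sin (nodeAngle p.1 / 2) :=
    Real.sin_pos_of_pos_of_lt_pi (by linarith) (by linarith)
  have hc : 0 < Real.cos (nodeAngle p.1 / 2) :=
    Real.cos_pos_of_mem_Ioo ⟨by linarith, by linarith⟩
  rw [Matrix.col_apply, djt, Matrix.of_apply, wignerD_eq t hs hc, Pi.smul_apply, symVec, pointSU,
    colNorm, t.j_eq, smul_eq_mul]
  rw [show ((t.left : ℝ) + t.left') / 2 + 1 / 2 = ((t.left : ℝ) + t.left' + 1) / 2 by ring]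
  push_cast
  ring

lemma colNorm_sq_mul_normSqSymVec {l l' r r' : ℕ} (h : l + l' = r + r') :
    (colNorm l l' r r' : ℂ) * colNorm l l' r r' * normSqSymVec l l' r' = 1 := by
  have h1 : colNorm l l' r r' * colNorm l l' r r' =
      ((l : ℝ) + l' + 1) / 2 * ((r.factorial * r'.factorial) / (l.factorial * l'.factorial)) := by
    rw [colNorm, mul_mul_mul_comm, Real.mul_self_sqrt (by positivity),
      Real.mul_self_sqrt (by positivity)]
  have h2 : ((r + r').factorial : ℂ) = (r + r').choose r' * r'.factorial * r.factorial := by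
    have := Nat.choose_mul_factorial_mul_factorial (Nat.le_add_left r' r)
    rw [Nat.add_sub_cancel] at this
    exact_mod_cast this.symm
  have h3 : ((l + l' + 1).factorial : ℂ) = (l + l' + 1) * (l + l').factorial := by
    rw [Nat.factorial_succ]; push_cast; ring
  have hc : ((r + r').choose r' : ℂ) ≠ 0 := by
    exact_mod_cast (Nat.choose_pos (Nat.le_add_left r' r)).ne'
  have hf : ∀ n : ℕ, (n.factorial : ℂ) ≠ 0 := fun n => by exact_mod_cast Nat.factorial_ne_zero n
  have hl := cast_add_add_one_ne_zero l l'
  have := hf l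
  have := hf l'
  have := hf r
  have := hf r'
  rw [← Complex.ofReal_mul, h1, normSqSymVec, h3, binom_natCast, h, h2]
  push_cast
  field_simp

lemma Triplet.ext_of_eq {Q : ℕ} {t t' : Triplet Q} (h1 : t.left = t'.left)
    (h2 : t.left' = t'.left') (h3 : t.right' = t'.right') : t = t' := by
  have e1 := t.left_add_left'
  have e2 := t'.left_add_left'
  have e3 := t.right_add_right'
  have e4 := t'.right_add_right'
  have h4 : t.twoJ = t'.twoJ := by omega
  have h5 : t.right = t'.right := by omega
  obtain ⟨k, a, b⟩ := t
  obtain ⟨k', a', b'⟩ := t'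
  obtain rfl : k = k' := Fin.ext h4
  obtain rfl : a = a' := Fin.ext h1
  obtain rfl : b = b' := Fin.ext h5
  rfl

lemma djt_conjTranspose_mul_self {Q Nθ Nφ Nψ : ℕ} (hθ : Q < 2 * Nθ) (hφ : 2 * Q < Nφ)
    (hψ : 2 * Q < Nψ) {w : Node Nθ → ℝ} (hw : IsGaussianWeights Nθ w) :
    (djt Q Nφ Nψ w)ᴴ * djt Q Nφ Nψ w = 1 := by
  ext t t'
  have h1 : ((djt Q Nφ Nψ w)ᴴ * djt Q Nφ Nψ w) t t' =
      star ((djt Q Nφ Nψ w).col t) ⬝ᵥ (djt Q Nφ Nψ w).col t' := rfl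
  have e1 := t.left_add_left'
  have e2 := t'.left_add_left'
  have e3 := t.twoJ_le
  have e4 := t'.twoJ_le
  have h2 := symInner_eq hθ hφ hψ hw (l := t.left) (l' := t.left') (m := t'.left) (m' := t'.left')
    (by omega) t.right' t'.right'
  rw [symInner] at h2
  rw [h1, col_djt, col_djt, star_smul, smul_dotProduct, dotProduct_smul, h2, Matrix.one_apply,
    Complex.star_def, Complex.conj_ofReal]
  by_cases h : t = t'
  · subst h
    rw [if_pos rfl, if_pos ⟨rfl, rfl, rfl⟩, smul_eq_mul, smul_eq_mul, ← mul_assoc]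
    exact colNorm_sq_mul_normSqSymVec (t.left_add_left'.trans t.right_add_right'.symm)
  · rw [if_neg h, if_neg, smul_zero, smul_zero]
    rintro ⟨h3, h4, h5⟩
    exact h (Triplet.ext_of_eq h3 h4 (by exact_mod_cast h5))

/-! ### Ladder operators -/

/-- The triplet with `j + m_L = l`, `j - m_L = l'`, `j + m_R = r` and `j - m_R = r'`. -/
def Triplet.ofNat {Q : ℕ} (l l' r r' : ℕ) (h : l + l' = r + r') (hQ : l + l' ≤ Q) : Triplet Q :=
  ⟨⟨l + l', by omega⟩, ⟨l, by simp only; omega⟩, ⟨r, by simp only; omega⟩⟩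

section OfNat

variable {Q l l' r r' : ℕ} (h : l + l' = r + r') (hQ : l + l' ≤ Q)

lemma Triplet.twoJ_ofNat : (Triplet.ofNat l l' r r' h hQ).twoJ = l + l' := rfl
lemma Triplet.left_ofNat : (Triplet.ofNat l l' r r' h hQ).left = l := rfl
lemma Triplet.right_ofNat : (Triplet.ofNat l l' r r' h hQ).right = r := rfl
lemma Triplet.left'_ofNat : (Triplet.ofNat l l' r r' h hQ).left' = l' :=
  Nat.add_sub_cancel_left l l'
lemma Triplet.right'_ofNat : (Triplet.ofNat l l' r r' h hQ).right' = r' := by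
  simp only [Triplet.right', Triplet.twoJ_ofNat, Triplet.right_ofNat, h, Nat.add_sub_cancel_left]

lemma Triplet.eq_ofNat_iff (t : Triplet Q) : t = Triplet.ofNat l l' r r' h hQ ↔
    t.twoJ = l + l' ∧ t.left = l ∧ t.right = r := by
  refine ⟨by rintro rfl; exact ⟨rfl, rfl, rfl⟩, fun ⟨h1, h2, h3⟩ => ?_⟩
  have e1 := t.left_add_left'
  have e2 := t.right_add_right'
  refine Triplet.ext_of_eq ?_ ?_ ?_
  · rw [h2, left_ofNat]
  · rw [left'_ofNat]; omega
  · rw [right'_ofNat]; omega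

end OfNat

section Ladder

variable {Q Nθ Nφ Nψ : ℕ} {w : Node Nθ → ℝ}

/-- The operator in the magnetic basis that corresponds to a matrix in the electric basis. -/
def conjDJT (Nφ Nψ : ℕ) (w : Node Nθ → ℝ) (H : Matrix (Triplet Q) (Triplet Q) ℂ) :
    Matrix (Point Nθ Nφ Nψ) (Point Nθ Nφ Nψ) ℂ :=
  djt Q Nφ Nψ w * H * (djt Q Nφ Nψ w)ᴴ

lemma conjDJT_mulVec_col (hV : (djt Q Nφ Nψ w)ᴴ * djt Q Nφ Nψ w = 1)
    (H : Matrix (Triplet Q) (Triplet Q) ℂ) (t : Triplet Q) :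
    conjDJT Nφ Nψ w H *ᵥ (djt Q Nφ Nψ w).col t = djt Q Nφ Nψ w *ᵥ H.col t := by
  have h : ∀ {α : Type} [Fintype α] (A : Matrix α (Triplet Q) ℂ),
      A.col t = A *ᵥ Pi.single t 1 := fun A => (Matrix.mulVec_single_one A t).symm
  rw [h, h, Matrix.mulVec_mulVec, Matrix.mulVec_mulVec, conjDJT, Matrix.mul_assoc, hV,
    Matrix.mul_one]

lemma symVec_eq_smul_col {l l' r r' : ℕ} (h : l + l' = r + r') (hQ : l + l' ≤ Q) :
    symVec Nφ Nψ w l l' r' = (colNorm l l' r r' : ℂ)⁻¹ •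
      (djt Q Nφ Nψ w).col (Triplet.ofNat l l' r r' h hQ) := by
  have h0 : (colNorm l l' r r' : ℂ) ≠ 0 := by exact_mod_cast (colNorm_pos l l' r r').ne'
  rw [col_djt, Triplet.left_ofNat, Triplet.left'_ofNat, Triplet.right_ofNat, Triplet.right'_ofNat,
    smul_smul, inv_mul_cancel₀ h0, one_smul]

/-- If `H` maps the basis vector of one triplet to `c` times that of another, the operator `V H V†`
does the same with the sampled coefficients, with `c` rescaled by the ratio of the column norms. -/
lemma conjDJT_mulVec_symVec (hV : (djt Q Nφ Nψ w)ᴴ * djt Q Nφ Nψ w = 1)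
    {H : Matrix (Triplet Q) (Triplet Q) ℂ} {l l' r r' m m' s s' : ℕ} (h : l + l' = r + r')
    (hQ : l + l' ≤ Q) (h' : m + m' = s + s') (hQ' : m + m' ≤ Q) {c : ℂ} {d : ℝ}
    (hH : ∀ t, H t (Triplet.ofNat l l' r r' h hQ) =
      if t = Triplet.ofNat m m' s s' h' hQ' then c else 0)
    (hcd : c * colNorm m m' s s' = d * colNorm l l' r r') :
    conjDJT Nφ Nψ w H *ᵥ symVec Nφ Nψ w l l' r' = (d : ℂ) • symVec Nφ Nψ w m m' s' := by
  have h0 : (colNorm l l' r r' : ℂ) ≠ 0 := by exact_mod_cast (colNorm_pos l l' r r').ne'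
  have h1 : H.col (Triplet.ofNat l l' r r' h hQ) =
      c • Pi.single (Triplet.ofNat m m' s s' h' hQ') 1 := by
    funext t
    rw [Matrix.col_apply, hH, Pi.smul_apply, Pi.single_apply]
    split_ifs <;> simp
  rw [symVec_eq_smul_col h hQ, Matrix.mulVec_smul, conjDJT_mulVec_col hV, h1, Matrix.mulVec_smul,
    Matrix.mulVec_single_one, col_djt, Triplet.left_ofNat, Triplet.left'_ofNat,
    Triplet.right_ofNat, Triplet.right'_ofNat, smul_smul, smul_smul, mul_assoc, hcd]
  congr 1
  field_simp

lemma conjDJT_mulVec_symVec_eq_zero (hV : (djt Q Nφ Nψ w)ᴴ * djt Q Nφ Nψ w = 1)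
    {H : Matrix (Triplet Q) (Triplet Q) ℂ} {l l' r r' : ℕ} (h : l + l' = r + r')
    (hQ : l + l' ≤ Q) (hH : ∀ t, H t (Triplet.ofNat l l' r r' h hQ) = 0) :
    conjDJT Nφ Nψ w H *ᵥ symVec Nφ Nψ w l l' r' = 0 := by
  have h1 : H.col (Triplet.ofNat l l' r r' h hQ) = 0 := funext hH
  rw [symVec_eq_smul_col h hQ, Matrix.mulVec_smul, conjDJT_mulVec_col hV, h1, Matrix.mulVec_zero,
    smul_zero]

lemma symVec_eq_zero {l l' : ℕ} {z : ℤ} (hz : ¬(0 ≤ z ∧ z ≤ l + l')) :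
    symVec Nφ Nψ w l l' z = 0 := by
  funext p
  rw [symVec]
  rcases not_and_or.1 hz with h | h
  · rw [symCoeff_of_neg _ _ _ (by omega), mul_zero]; rfl
  · rw [symCoeff_of_lt _ _ _ (by omega), mul_zero]; rfl

lemma sqrt_mul_sqrt_eq {x y c y' : ℝ} (hx : 0 ≤ x) (hc : 0 ≤ c) (h : x * y = c ^ 2 * y') :
    Real.sqrt x * Real.sqrt y = c * Real.sqrt y' := by
  rw [← Real.sqrt_mul hx, h, Real.sqrt_mul (sq_nonneg c), Real.sqrt_sq hc]

/-- With `a = j + m_L` and `b + 1 = j - m_L`, the matrix element of `L̂_1 + i L̂_2` is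
`√((b + 1) (a + 1))`; the column norms turn it into the integer `j - m_L`. -/
lemma sqrt_mul_colNorm_left (a b r r' : ℕ) :
    Real.sqrt ((b + 1) * (a + 1)) * colNorm (a + 1) b r r' = (b + 1) * colNorm a (b + 1) r r' := by
  have h := sqrt_mul_sqrt_eq (x := (b + 1) * (a + 1)) (c := b + 1)
    (y := (r.factorial * r'.factorial) / ((a + 1).factorial * b.factorial))
    (y' := (r.factorial * r'.factorial) / (a.factorial * (b + 1).factorial))
    (by positivity) (by positivity) (by
      rw [Nat.factorial_succ, Nat.factorial_succ]; push_cast; field_simp)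
  rw [colNorm, colNorm, mul_left_comm, h, show ((a + 1 : ℕ) : ℝ) + b = a + (b + 1 : ℕ) by
    push_cast; ring]
  ring

lemma sqrt_mul_colNorm_left' (a b r r' : ℕ) :
    Real.sqrt ((b + 1) * (a + 1)) * colNorm a (b + 1) r r' = (a + 1) * colNorm (a + 1) b r r' := by
  have h := sqrt_mul_colNorm_left a b r r'
  have h1 := Real.mul_self_sqrt (by positivity : (0 : ℝ) ≤ (b + 1) * (a + 1))
  have h2 : ((b : ℝ) + 1) ≠ 0 := by positivity
  apply mul_left_cancel₀ h2
  linear_combination -Real.sqrt ((b + 1) * (a + 1)) * h + colNorm (a + 1) b r r' * h1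

lemma sqrt_mul_colNorm_right (l l' a b : ℕ) :
    Real.sqrt ((b + 1) * (a + 1)) * colNorm l l' (a + 1) b = (a + 1) * colNorm l l' a (b + 1) := by
  have h := sqrt_mul_sqrt_eq (x := (b + 1) * (a + 1)) (c := a + 1)
    (y := ((a + 1).factorial * b.factorial) / (l.factorial * l'.factorial))
    (y' := (a.factorial * (b + 1).factorial) / (l.factorial * l'.factorial))
    (by positivity) (by positivity) (by
      rw [Nat.factorial_succ, Nat.factorial_succ]; push_cast; field_simp)
  rw [colNorm, colNorm, mul_left_comm, h]
  ring

lemma sqrt_mul_colNorm_right' (l l' a b : ℕ) :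
    Real.sqrt ((b + 1) * (a + 1)) * colNorm l l' a (b + 1) = (b + 1) * colNorm l l' (a + 1) b := by
  have h := sqrt_mul_colNorm_right l l' a b
  have h1 := Real.mul_self_sqrt (by positivity : (0 : ℝ) ≤ (b + 1) * (a + 1))
  have h2 : ((a : ℝ) + 1) ≠ 0 := by positivity
  apply mul_left_cancel₀ h2
  linear_combination -Real.sqrt ((b + 1) * (a + 1)) * h + colNorm l l' (a + 1) b * h1

lemma Triplet.j_eq_right (t : Triplet Q) : t.j = ((t.right : ℝ) + t.right') / 2 := by
  rw [j, ← right_add_right']; push_cast; ring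

/-- The raising operator replaces a factor `-g₁₂ + g₁₁ Z` of the binary form by `g₂₂ - g₂₁ Z`. The
statement covers all integers `z`: outside `0 ≤ z ≤ l + l'` both sides vanish. -/
lemma hatLPlus_mulVec (hV : (djt Q Nφ Nψ w)ᴴ * djt Q Nφ Nψ w = 1) {l l' : ℕ} (hQ : l + l' ≤ Q)
    (z : ℤ) : conjDJT Nφ Nψ w (hatLPlus Q) *ᵥ symVec Nφ Nψ w l l' z =
      (l' : ℂ) • symVec Nφ Nψ w (l + 1) (l' - 1) z := by
  by_cases hz : 0 ≤ z ∧ z ≤ l + l'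
  swap
  · rw [symVec_eq_zero hz, Matrix.mulVec_zero]
    rcases l' with _ | k
    · simp
    · rw [symVec_eq_zero (by push_cast [Nat.add_sub_cancel] at hz ⊢; omega), smul_zero]
  obtain ⟨r', rfl⟩ := Int.eq_ofNat_of_zero_le hz.1
  obtain ⟨r, hr⟩ : ∃ r, l + l' = r + r' := ⟨l + l' - r', by omega⟩
  rcases l' with _ | k
  · rw [Nat.cast_zero, zero_smul]
    refine conjDJT_mulVec_symVec_eq_zero hV hr hQ fun t => ?_
    have ht := t.left_add_left'
    rw [hatLPlus, Matrix.of_apply, if_neg]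
    simp only [Triplet.twoJ_ofNat, Triplet.left_ofNat]
    omega
  · refine (conjDJT_mulVec_symVec hV (m := l + 1) (m' := k) (s := r) (s' := r') hr hQ
      (by omega) (by omega)
      (c := (Real.sqrt ((k + 1) * (l + 1)) : ℝ)) (d := (k + 1)) (fun t => ?_) ?_).trans ?_
    · rw [hatLPlus, Matrix.of_apply]
      refine if_congr (Iff.trans ?_ (Triplet.eq_ofNat_iff _ _ t).symm) ?_ rfl
      · simp only [Triplet.twoJ_ofNat, Triplet.left_ofNat, Triplet.right_ofNat]
        omega
      rw [Triplet.j_eq, Triplet.mL_eq, Triplet.left_ofNat, Triplet.left'_ofNat]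
      congr 2
      push_cast; ring
    · exact_mod_cast sqrt_mul_colNorm_left l k r r'
    · push_cast; rfl

lemma hatLMinus_mulVec (hV : (djt Q Nφ Nψ w)ᴴ * djt Q Nφ Nψ w = 1) {l l' : ℕ} (hQ : l + l' ≤ Q)
    (z : ℤ) : conjDJT Nφ Nψ w (hatLMinus Q) *ᵥ symVec Nφ Nψ w l l' z =
      (l : ℂ) • symVec Nφ Nψ w (l - 1) (l' + 1) z := by
  by_cases hz : 0 ≤ z ∧ z ≤ l + l'
  swap
  · rw [symVec_eq_zero hz, Matrix.mulVec_zero]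
    rcases l with _ | k
    · simp
    · rw [symVec_eq_zero (by push_cast [Nat.add_sub_cancel] at hz ⊢; omega), smul_zero]
  obtain ⟨r', rfl⟩ := Int.eq_ofNat_of_zero_le hz.1
  obtain ⟨r, hr⟩ : ∃ r, l + l' = r + r' := ⟨l + l' - r', by omega⟩
  rcases l with _ | k
  · rw [Nat.cast_zero, zero_smul]
    refine conjDJT_mulVec_symVec_eq_zero hV hr hQ fun t => ?_
    rw [hatLMinus, Matrix.of_apply, if_neg]
    simp only [Triplet.left_ofNat]
    omega
  · refine (conjDJT_mulVec_symVec hV (m := k) (m' := l' + 1) (s := r) (s' := r') hr hQ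
      (by omega) (by omega)
      (c := (Real.sqrt ((l' + 1) * (k + 1)) : ℝ)) (d := (k + 1)) (fun t => ?_) ?_).trans ?_
    · rw [hatLMinus, Matrix.of_apply]
      refine if_congr (Iff.trans ?_ (Triplet.eq_ofNat_iff _ _ t).symm) ?_ rfl
      · simp only [Triplet.twoJ_ofNat, Triplet.left_ofNat, Triplet.right_ofNat]
        omega
      rw [Triplet.j_eq, Triplet.mL_eq, Triplet.left_ofNat, Triplet.left'_ofNat]
      congr 2
      push_cast; ring
    · exact_mod_cast sqrt_mul_colNorm_left' k l' r r'
    · push_cast; rfl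

lemma hatRMinus_mulVec (hV : (djt Q Nφ Nψ w)ᴴ * djt Q Nφ Nψ w = 1) {l l' : ℕ} (hQ : l + l' ≤ Q)
    (z : ℤ) : conjDJT Nφ Nψ w (hatRMinus Q) *ᵥ symVec Nφ Nψ w l l' z =
      -(l + l' - z + 1 : ℂ) • symVec Nφ Nψ w l l' (z - 1) := by
  by_cases hz : 0 ≤ z ∧ z ≤ l + l'
  swap
  · rw [symVec_eq_zero hz, Matrix.mulVec_zero]
    by_cases h1 : z = l + l' + 1
    · subst h1; push_cast; simp
    · rw [symVec_eq_zero (by omega), smul_zero]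
  obtain ⟨r', rfl⟩ := Int.eq_ofNat_of_zero_le hz.1
  obtain ⟨r, hr⟩ : ∃ r, l + l' = r + r' := ⟨l + l' - r', by omega⟩
  rcases r' with _ | k
  · rw [symVec_eq_zero (by omega : ¬(0 ≤ ((0 : ℕ) : ℤ) - 1 ∧ _)), smul_zero]
    refine conjDJT_mulVec_symVec_eq_zero hV hr hQ fun t => ?_
    have ht := t.right_add_right'
    rw [hatRMinus, Matrix.of_apply, if_neg]
    simp only [Triplet.twoJ_ofNat, Triplet.right_ofNat]
    omega
  · refine (conjDJT_mulVec_symVec hV (s := r + 1) (s' := k) hr hQ (by omega) hQ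
      (c := -(Real.sqrt ((k + 1) * (r + 1)) : ℝ)) (d := -(r + 1)) (fun t => ?_) ?_).trans ?_
    · rw [hatRMinus, Matrix.of_apply]
      refine if_congr (Iff.trans ?_ (Triplet.eq_ofNat_iff _ _ t).symm) ?_ rfl
      · simp only [Triplet.twoJ_ofNat, Triplet.left_ofNat, Triplet.right_ofNat]
      rw [Triplet.j_eq_right, Triplet.mR_eq, Triplet.right_ofNat, Triplet.right'_ofNat]
      congr 3
      push_cast; ring
    · have h := sqrt_mul_colNorm_right l l' r k
      have h' : ((Real.sqrt ((k + 1) * (r + 1)) : ℝ) : ℂ) * colNorm l l' (r + 1) k =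
        (r + 1) * colNorm l l' r (k + 1) := by exact_mod_cast h
      push_cast
      linear_combination -h'
    · have h : ((l : ℂ) + l') = r + (k + 1) := by exact_mod_cast hr
      rw [h]
      push_cast
      rw [add_sub_cancel_right (k : ℤ) 1]
      congr 1; ring

/-- `R_1 + i R_2` acts on the binary forms as `-d/dZ`; at `z = -1`, where the shifted
coefficient need not vanish, the factor `z + 1` does. -/
lemma hatRPlus_mulVec (hV : (djt Q Nφ Nψ w)ᴴ * djt Q Nφ Nψ w = 1) {l l' : ℕ} (hQ : l + l' ≤ Q)
    (z : ℤ) : conjDJT Nφ Nψ w (hatRPlus Q) *ᵥ symVec Nφ Nψ w l l' z =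
      -(z + 1 : ℂ) • symVec Nφ Nψ w l l' (z + 1) := by
  by_cases hz : 0 ≤ z ∧ z ≤ l + l'
  swap
  · rw [symVec_eq_zero hz, Matrix.mulVec_zero]
    by_cases h1 : z = -1
    · subst h1; simp
    · rw [symVec_eq_zero (by omega), smul_zero]
  obtain ⟨r', rfl⟩ := Int.eq_ofNat_of_zero_le hz.1
  obtain ⟨r, hr⟩ : ∃ r, l + l' = r + r' := ⟨l + l' - r', by omega⟩
  rcases r with _ | k
  · rw [symVec_eq_zero (by omega : ¬(0 ≤ (r' : ℤ) + 1 ∧ (r' : ℤ) + 1 ≤ l + l')), smul_zero]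
    refine conjDJT_mulVec_symVec_eq_zero hV hr hQ fun t => ?_
    rw [hatRPlus, Matrix.of_apply, if_neg]
    simp only [Triplet.right_ofNat]
    omega
  · refine (conjDJT_mulVec_symVec hV (s := k) (s' := r' + 1) hr hQ (by omega) hQ
      (c := -(Real.sqrt ((r' + 1) * (k + 1)) : ℝ)) (d := -(r' + 1)) (fun t => ?_) ?_).trans ?_
    · rw [hatRPlus, Matrix.of_apply]
      refine if_congr (Iff.trans ?_ (Triplet.eq_ofNat_iff _ _ t).symm) ?_ rfl
      · simp only [Triplet.twoJ_ofNat, Triplet.left_ofNat, Triplet.right_ofNat]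
        omega
      rw [Triplet.j_eq_right, Triplet.mR_eq, Triplet.right_ofNat, Triplet.right'_ofNat]
      congr 3
      push_cast; ring
    · have h := sqrt_mul_colNorm_right' l l' k r'
      have h' : ((Real.sqrt ((r' + 1) * (k + 1)) : ℝ) : ℂ) * colNorm l l' k (r' + 1) =
        (r' + 1) * colNorm l l' (k + 1) r' := by exact_mod_cast h
      push_cast
      linear_combination -h'
    · push_cast; rfl

lemma hatL_two_mulVec (hV : (djt Q Nφ Nψ w)ᴴ * djt Q Nφ Nψ w = 1) {l l' : ℕ} (hQ : l + l' ≤ Q)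
    (z : ℤ) : conjDJT Nφ Nψ w (hatL Q 2) *ᵥ symVec Nφ Nψ w l l' z =
      (((l : ℂ) - l') / 2) • symVec Nφ Nψ w l l' z := by
  by_cases hz : 0 ≤ z ∧ z ≤ l + l'
  swap
  · rw [symVec_eq_zero hz, Matrix.mulVec_zero, smul_zero]
  obtain ⟨r', rfl⟩ := Int.eq_ofNat_of_zero_le hz.1
  obtain ⟨r, hr⟩ : ∃ r, l + l' = r + r' := ⟨l + l' - r', by omega⟩
  refine (conjDJT_mulVec_symVec hV hr hQ hr hQ (c := (((l : ℝ) - l') / 2 : ℝ))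
    (d := ((l : ℝ) - l') / 2) (fun t => ?_) rfl).trans (by push_cast; rfl)
  change Matrix.diagonal (fun t : Triplet Q => (t.mL : ℂ)) _ _ = _
  rw [Matrix.diagonal_apply]
  refine ite_congr rfl (fun h => ?_) (fun _ => rfl)
  rw [h, Triplet.mL_eq, Triplet.left_ofNat, Triplet.left'_ofNat]

lemma hatR_two_mulVec (hV : (djt Q Nφ Nψ w)ᴴ * djt Q Nφ Nψ w = 1) {l l' : ℕ} (hQ : l + l' ≤ Q)
    (z : ℤ) : conjDJT Nφ Nψ w (hatR Q 2) *ᵥ symVec Nφ Nψ w l l' z =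
      ((z : ℂ) - (l + l') / 2) • symVec Nφ Nψ w l l' z := by
  by_cases hz : 0 ≤ z ∧ z ≤ l + l'
  swap
  · rw [symVec_eq_zero hz, Matrix.mulVec_zero, smul_zero]
  obtain ⟨r', rfl⟩ := Int.eq_ofNat_of_zero_le hz.1
  obtain ⟨r, hr⟩ : ∃ r, l + l' = r + r' := ⟨l + l' - r', by omega⟩
  have hr' : ((l : ℂ) + l') = r + r' := by exact_mod_cast hr
  refine (conjDJT_mulVec_symVec hV hr hQ hr hQ (c := (-(((r : ℝ) - r') / 2) : ℝ))
    (d := -(((r : ℝ) - r') / 2)) (fun t => ?_) rfl).trans (by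
      rw [hr']; push_cast; congr 1; ring)
  change Matrix.diagonal (fun t : Triplet Q => -(t.mR : ℂ)) _ _ = _
  rw [Matrix.diagonal_apply]
  refine ite_congr rfl (fun h => ?_) (fun _ => rfl)
  rw [h, Triplet.mR_eq, Triplet.right_ofNat, Triplet.right'_ofNat, Complex.ofReal_neg]

end Ladder

/-! ### Commutation relations -/

section Commutation

variable {Q Nθ Nφ Nψ : ℕ} {w : Node Nθ → ℝ}

/-- The relation `[L, U] = -T U` on the sampled matrix coefficients of spin below `Q / 2`, where `L`
is the magnetic-basis form of `H`. -/
def LeftCommutes (Nφ Nψ : ℕ) (w : Node Nθ → ℝ) (H : Matrix (Triplet Q) (Triplet Q) ℂ)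
    (T : Matrix (Fin 2) (Fin 2) ℂ) : Prop :=
  ∀ (l l' : ℕ) (z : ℤ), l + l' < Q → ∀ c d : Fin 2,
    (conjDJT Nφ Nψ w H * link Nθ Nφ Nψ c d - link Nθ Nφ Nψ c d * conjDJT Nφ Nψ w H) *ᵥ
      symVec Nφ Nψ w l l' z = -((∑ e, T c e • link Nθ Nφ Nψ e d) *ᵥ symVec Nφ Nψ w l l' z)

/-- The relation `[R, U] = U T` on the sampled matrix coefficients of spin below `Q / 2`, where `R`
is the magnetic-basis form of `H`. -/
def RightCommutes (Nφ Nψ : ℕ) (w : Node Nθ → ℝ) (H : Matrix (Triplet Q) (Triplet Q) ℂ)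
    (T : Matrix (Fin 2) (Fin 2) ℂ) : Prop :=
  ∀ (l l' : ℕ) (z : ℤ), l + l' < Q → ∀ c d : Fin 2,
    (conjDJT Nφ Nψ w H * link Nθ Nφ Nψ c d - link Nθ Nφ Nψ c d * conjDJT Nφ Nψ w H) *ᵥ
      symVec Nφ Nψ w l l' z = (∑ e, T e d • link Nθ Nφ Nψ c e) *ᵥ symVec Nφ Nψ w l l' z

/-- Both products are expanded in the sampled coefficients of degrees `l + l' ± 1 ≤ Q`, on which the
action of `L_1 + i L_2` is known, and compared term by term. This is where `l + l' < Q` is needed.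
The other components are treated alike. -/
lemma leftCommutes_hatLPlus (hV : (djt Q Nφ Nψ w)ᴴ * djt Q Nφ Nψ w = 1) :
    LeftCommutes Nφ Nψ w (hatLPlus Q) !![0, 1; 0, 0] := by
  intro l l' z hl c d
  have h1 : l + l' ≤ Q := hl.le
  have h2 : l + (l' + 1) ≤ Q := hl
  have h3 : l + 1 + l' ≤ Q := by omega
  have h4 : l - 1 + l' ≤ Q := by omega
  have h5 : l + (l' - 1) ≤ Q := by omega
  rw [Fin.sum_univ_two, Matrix.sub_mulVec, ← Matrix.mulVec_mulVec, ← Matrix.mulVec_mulVec,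
    hatLPlus_mulVec hV h1, Matrix.add_mulVec, Matrix.smul_mulVec, Matrix.smul_mulVec]
  fin_cases c <;> fin_cases d <;>
    simp only [Fin.zero_eta, Fin.mk_one, Fin.isValue, Matrix.of_apply, Matrix.cons_val',
      Matrix.cons_val_zero, Matrix.cons_val_one, Matrix.cons_val_fin_one,
      link_zero_zero_mulVec_symVec, link_zero_one_mulVec_symVec, link_one_zero_mulVec_symVec,
      link_one_one_mulVec_symVec, Matrix.mulVec_smul, Matrix.mulVec_add, hatLPlus_mulVec hV h2,
      hatLPlus_mulVec hV h3, hatLPlus_mulVec hV h4, hatLPlus_mulVec hV h5] <;>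
    rcases l with _ | l <;> rcases l' with _ | l' <;>
    simp only [Nat.add_sub_cancel, Nat.cast_zero, Nat.zero_sub, Nat.zero_add] <;>
    match_scalars <;> ring

lemma leftCommutes_hatLMinus (hV : (djt Q Nφ Nψ w)ᴴ * djt Q Nφ Nψ w = 1) :
    LeftCommutes Nφ Nψ w (hatLMinus Q) !![0, 0; 1, 0] := by
  intro l l' z hl c d
  have h1 : l + l' ≤ Q := hl.le
  have h2 : l + (l' + 1) ≤ Q := hl
  have h3 : l + 1 + l' ≤ Q := by omega
  have h4 : l - 1 + l' ≤ Q := by omega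
  have h5 : l + (l' - 1) ≤ Q := by omega
  rw [Fin.sum_univ_two, Matrix.sub_mulVec, ← Matrix.mulVec_mulVec, ← Matrix.mulVec_mulVec,
    hatLMinus_mulVec hV h1, Matrix.add_mulVec, Matrix.smul_mulVec, Matrix.smul_mulVec]
  fin_cases c <;> fin_cases d <;>
    simp only [Fin.zero_eta, Fin.mk_one, Fin.isValue, Matrix.of_apply, Matrix.cons_val',
      Matrix.cons_val_zero, Matrix.cons_val_one, Matrix.cons_val_fin_one,
      link_zero_zero_mulVec_symVec, link_zero_one_mulVec_symVec, link_one_zero_mulVec_symVec,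
      link_one_one_mulVec_symVec, Matrix.mulVec_smul, Matrix.mulVec_add, hatLMinus_mulVec hV h2,
      hatLMinus_mulVec hV h3, hatLMinus_mulVec hV h4, hatLMinus_mulVec hV h5] <;>
    rcases l with _ | l <;> rcases l' with _ | l' <;>
    simp only [Nat.add_sub_cancel, Nat.cast_zero, Nat.zero_sub, Nat.zero_add] <;>
    match_scalars <;> ring

lemma leftCommutes_hatL_two (hV : (djt Q Nφ Nψ w)ᴴ * djt Q Nφ Nψ w = 1) :
    LeftCommutes Nφ Nψ w (hatL Q 2) !![1 / 2, 0; 0, -1 / 2] := by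
  intro l l' z hl c d
  have h1 : l + l' ≤ Q := hl.le
  have h2 : l + (l' + 1) ≤ Q := hl
  have h3 : l + 1 + l' ≤ Q := by omega
  have h4 : l - 1 + l' ≤ Q := by omega
  have h5 : l + (l' - 1) ≤ Q := by omega
  rw [Fin.sum_univ_two, Matrix.sub_mulVec, ← Matrix.mulVec_mulVec, ← Matrix.mulVec_mulVec,
    hatL_two_mulVec hV h1, Matrix.add_mulVec, Matrix.smul_mulVec, Matrix.smul_mulVec]
  fin_cases c <;> fin_cases d <;>
    simp only [Fin.zero_eta, Fin.mk_one, Fin.isValue, Matrix.of_apply, Matrix.cons_val',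
      Matrix.cons_val_zero, Matrix.cons_val_one, Matrix.cons_val_fin_one,
      link_zero_zero_mulVec_symVec, link_zero_one_mulVec_symVec, link_one_zero_mulVec_symVec,
      link_one_one_mulVec_symVec, Matrix.mulVec_smul, Matrix.mulVec_add, hatL_two_mulVec hV h2,
      hatL_two_mulVec hV h3, hatL_two_mulVec hV h4, hatL_two_mulVec hV h5] <;>
    rcases l with _ | l <;> rcases l' with _ | l' <;>
    simp only [Nat.add_sub_cancel, Nat.cast_zero, Nat.zero_sub, Nat.zero_add] <;>
    match_scalars <;> ring

lemma rightCommutes_hatRPlus (hV : (djt Q Nφ Nψ w)ᴴ * djt Q Nφ Nψ w = 1) :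
    RightCommutes Nφ Nψ w (hatRPlus Q) !![0, 1; 0, 0] := by
  intro l l' z hl c d
  have h1 : l + l' ≤ Q := hl.le
  have h2 : l + (l' + 1) ≤ Q := hl
  have h3 : l + 1 + l' ≤ Q := by omega
  have h4 : l - 1 + l' ≤ Q := by omega
  have h5 : l + (l' - 1) ≤ Q := by omega
  rw [Fin.sum_univ_two, Matrix.sub_mulVec, ← Matrix.mulVec_mulVec, ← Matrix.mulVec_mulVec,
    hatRPlus_mulVec hV h1, Matrix.add_mulVec, Matrix.smul_mulVec, Matrix.smul_mulVec]
  fin_cases c <;> fin_cases d <;>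
    simp only [Fin.zero_eta, Fin.mk_one, Fin.isValue, Matrix.of_apply, Matrix.cons_val',
      Matrix.cons_val_zero, Matrix.cons_val_one, Matrix.cons_val_fin_one,
      link_zero_zero_mulVec_symVec, link_zero_one_mulVec_symVec, link_one_zero_mulVec_symVec,
      link_one_one_mulVec_symVec, Matrix.mulVec_smul, Matrix.mulVec_add, hatRPlus_mulVec hV h2,
      hatRPlus_mulVec hV h3, hatRPlus_mulVec hV h4, hatRPlus_mulVec hV h5] <;>
    rcases l with _ | l <;> rcases l' with _ | l' <;>
    simp only [Nat.add_sub_cancel, Nat.cast_zero, Nat.zero_sub, Nat.zero_add, sub_add_cancel,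
      add_sub_cancel_right] <;>
    match_scalars <;> ring

lemma rightCommutes_hatRMinus (hV : (djt Q Nφ Nψ w)ᴴ * djt Q Nφ Nψ w = 1) :
    RightCommutes Nφ Nψ w (hatRMinus Q) !![0, 0; 1, 0] := by
  intro l l' z hl c d
  have h1 : l + l' ≤ Q := hl.le
  have h2 : l + (l' + 1) ≤ Q := hl
  have h3 : l + 1 + l' ≤ Q := by omega
  have h4 : l - 1 + l' ≤ Q := by omega
  have h5 : l + (l' - 1) ≤ Q := by omega
  rw [Fin.sum_univ_two, Matrix.sub_mulVec, ← Matrix.mulVec_mulVec, ← Matrix.mulVec_mulVec,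
    hatRMinus_mulVec hV h1, Matrix.add_mulVec, Matrix.smul_mulVec, Matrix.smul_mulVec]
  fin_cases c <;> fin_cases d <;>
    simp only [Fin.zero_eta, Fin.mk_one, Fin.isValue, Matrix.of_apply, Matrix.cons_val',
      Matrix.cons_val_zero, Matrix.cons_val_one, Matrix.cons_val_fin_one,
      link_zero_zero_mulVec_symVec, link_zero_one_mulVec_symVec, link_one_zero_mulVec_symVec,
      link_one_one_mulVec_symVec, Matrix.mulVec_smul, Matrix.mulVec_add, hatRMinus_mulVec hV h2,
      hatRMinus_mulVec hV h3, hatRMinus_mulVec hV h4, hatRMinus_mulVec hV h5] <;>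
    rcases l with _ | l <;> rcases l' with _ | l' <;>
    simp only [Nat.add_sub_cancel, Nat.cast_zero, Nat.zero_sub, Nat.zero_add, sub_add_cancel,
      add_sub_cancel_right] <;>
    match_scalars <;> ring

lemma rightCommutes_hatR_two (hV : (djt Q Nφ Nψ w)ᴴ * djt Q Nφ Nψ w = 1) :
    RightCommutes Nφ Nψ w (hatR Q 2) !![1 / 2, 0; 0, -1 / 2] := by
  intro l l' z hl c d
  have h1 : l + l' ≤ Q := hl.le
  have h2 : l + (l' + 1) ≤ Q := hl
  have h3 : l + 1 + l' ≤ Q := by omega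
  have h4 : l - 1 + l' ≤ Q := by omega
  have h5 : l + (l' - 1) ≤ Q := by omega
  rw [Fin.sum_univ_two, Matrix.sub_mulVec, ← Matrix.mulVec_mulVec, ← Matrix.mulVec_mulVec,
    hatR_two_mulVec hV h1, Matrix.add_mulVec, Matrix.smul_mulVec, Matrix.smul_mulVec]
  fin_cases c <;> fin_cases d <;>
    simp only [Fin.zero_eta, Fin.mk_one, Fin.isValue, Matrix.of_apply, Matrix.cons_val',
      Matrix.cons_val_zero, Matrix.cons_val_one, Matrix.cons_val_fin_one,
      link_zero_zero_mulVec_symVec, link_zero_one_mulVec_symVec, link_one_zero_mulVec_symVec,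
      link_one_one_mulVec_symVec, Matrix.mulVec_smul, Matrix.mulVec_add, hatR_two_mulVec hV h2,
      hatR_two_mulVec hV h3, hatR_two_mulVec hV h4, hatR_two_mulVec hV h5] <;>
    rcases l with _ | l <;> rcases l' with _ | l' <;>
    simp only [Nat.add_sub_cancel, Nat.cast_zero, Nat.zero_sub, Nat.zero_add] <;>
    match_scalars <;> ring

lemma conjDJT_add (H H' : Matrix (Triplet Q) (Triplet Q) ℂ) :
    conjDJT Nφ Nψ w (H + H') = conjDJT Nφ Nψ w H + conjDJT Nφ Nψ w H' := by
  simp only [conjDJT, Matrix.mul_add, Matrix.add_mul]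

lemma conjDJT_smul (k : ℂ) (H : Matrix (Triplet Q) (Triplet Q) ℂ) :
    conjDJT Nφ Nψ w (k • H) = k • conjDJT Nφ Nψ w H := by
  simp only [conjDJT, Matrix.mul_smul, Matrix.smul_mul]

lemma LeftCommutes.add_smul {H H' : Matrix (Triplet Q) (Triplet Q) ℂ}
    {T T' : Matrix (Fin 2) (Fin 2) ℂ} (h : LeftCommutes Nφ Nψ w H T)
    (h' : LeftCommutes Nφ Nψ w H' T') (k k' : ℂ) :
    LeftCommutes Nφ Nψ w (k • H + k' • H') (k • T + k' • T') := by
  intro l l' z hl c d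
  have e := h l l' z hl c d
  have e' := h' l l' z hl c d
  rw [Fin.sum_univ_two] at e e' ⊢
  simp only [conjDJT_add, conjDJT_smul, Matrix.add_mul, Matrix.mul_add, Matrix.smul_mul,
    Matrix.mul_smul, Matrix.sub_mulVec, Matrix.add_mulVec, Matrix.smul_mulVec, Matrix.add_apply,
    Matrix.smul_apply, smul_eq_mul] at e e' ⊢
  linear_combination (norm := module) k • e + k' • e'

lemma RightCommutes.add_smul {H H' : Matrix (Triplet Q) (Triplet Q) ℂ}
    {T T' : Matrix (Fin 2) (Fin 2) ℂ} (h : RightCommutes Nφ Nψ w H T)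
    (h' : RightCommutes Nφ Nψ w H' T') (k k' : ℂ) :
    RightCommutes Nφ Nψ w (k • H + k' • H') (k • T + k' • T') := by
  intro l l' z hl c d
  have e := h l l' z hl c d
  have e' := h' l l' z hl c d
  rw [Fin.sum_univ_two] at e e' ⊢
  simp only [conjDJT_add, conjDJT_smul, Matrix.add_mul, Matrix.mul_add, Matrix.smul_mul,
    Matrix.mul_smul, Matrix.sub_mulVec, Matrix.add_mulVec, Matrix.smul_mulVec, Matrix.add_apply,
    Matrix.smul_apply, smul_eq_mul] at e e' ⊢
  linear_combination (norm := module) k • e + k' • e'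

lemma hatL_zero : hatL Q 0 = (1 / 2 : ℂ) • hatLPlus Q + (1 / 2 : ℂ) • hatLMinus Q := by
  simp [hatL]

lemma hatL_one : hatL Q 1 = (1 / (2 * Complex.I) : ℂ) • hatLPlus Q +
    (-(1 / (2 * Complex.I)) : ℂ) • hatLMinus Q := by
  rw [neg_smul, ← sub_eq_add_neg, ← smul_sub]; rfl

lemma hatR_zero : hatR Q 0 = (1 / 2 : ℂ) • hatRPlus Q + (1 / 2 : ℂ) • hatRMinus Q := by
  simp [hatR]

lemma hatR_one : hatR Q 1 = (1 / (2 * Complex.I) : ℂ) • hatRPlus Q +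
    (-(1 / (2 * Complex.I)) : ℂ) • hatRMinus Q := by
  rw [neg_smul, ← sub_eq_add_neg, ← smul_sub]; rfl

lemma tau_zero : tau 0 = (1 / 2 : ℂ) • !![0, 1; 0, 0] + (1 / 2 : ℂ) • !![0, 0; 1, 0] := by
  ext i j; fin_cases i <;> fin_cases j <;> simp [tau]

lemma tau_one : tau 1 = (1 / (2 * Complex.I) : ℂ) • !![0, 1; 0, 0] +
    (-(1 / (2 * Complex.I)) : ℂ) • !![0, 0; 1, 0] := by
  ext i j; fin_cases i <;> fin_cases j <;> simp [tau, mul_comm]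

lemma tau_two : tau 2 = !![1 / 2, 0; 0, -1 / 2] := by
  ext i j; fin_cases i <;> fin_cases j <;> simp [tau]; norm_num

lemma leftCommutes_hatL (hV : (djt Q Nφ Nψ w)ᴴ * djt Q Nφ Nψ w = 1) (a : Fin 3) :
    LeftCommutes Nφ Nψ w (hatL Q a) (tau a) := by
  fin_cases a
  · exact hatL_zero (Q := Q) ▸ tau_zero ▸
      (leftCommutes_hatLPlus hV).add_smul (leftCommutes_hatLMinus hV) _ _
  · exact hatL_one (Q := Q) ▸ tau_one ▸
      (leftCommutes_hatLPlus hV).add_smul (leftCommutes_hatLMinus hV) _ _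
  · exact tau_two ▸ leftCommutes_hatL_two hV

lemma rightCommutes_hatR (hV : (djt Q Nφ Nψ w)ᴴ * djt Q Nφ Nψ w = 1) (a : Fin 3) :
    RightCommutes Nφ Nψ w (hatR Q a) (tau a) := by
  fin_cases a
  · exact hatR_zero (Q := Q) ▸ tau_zero ▸
      (rightCommutes_hatRPlus hV).add_smul (rightCommutes_hatRMinus hV) _ _
  · exact hatR_one (Q := Q) ▸ tau_one ▸
      (rightCommutes_hatRPlus hV).add_smul (rightCommutes_hatRMinus hV) _ _
  · exact tau_two ▸ rightCommutes_hatR_two hV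

/-- An identity between matrices on the low space may be checked on the sampled matrix
coefficients. -/
lemma mulVec_eq_of_mem_lowSpace {M M' : Matrix (Point Nθ Nφ Nψ) (Point Nθ Nφ Nψ) ℂ}
    (h : ∀ (l l' : ℕ) (z : ℤ), l + l' < Q →
      M *ᵥ symVec Nφ Nψ w l l' z = M' *ᵥ symVec Nφ Nψ w l l' z)
    {Φ : Point Nθ Nφ Nψ → ℂ} (hΦ : Φ ∈ lowSpace Q Nφ Nψ w) : M *ᵥ Φ = M' *ᵥ Φ := by
  refine LinearMap.eqOn_span (f := M.mulVecLin) (g := M'.mulVecLin) ?_ hΦ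
  rintro _ ⟨t, ht, rfl⟩
  rw [Matrix.mulVecLin_apply, Matrix.mulVecLin_apply, col_djt, Matrix.mulVec_smul,
    Matrix.mulVec_smul, h _ _ _ (by rwa [t.left_add_left'])]

/-! ### The quadratic Casimir operator and the dimension of the low space -/

lemma momL_eq (a : Fin 3) : momL Q Nφ Nψ w a = conjDJT Nφ Nψ w (hatL Q a) := rfl

lemma momR_eq (a : Fin 3) : momR Q Nφ Nψ w a = conjDJT Nφ Nψ w (hatR Q a) := rfl

/-- `X² + Y² = ½ (P M + M P)` for `P = X + i Y` and `M = X - i Y`. -/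
lemma sq_add_sq_of_ladder {α : Type*} [Fintype α] (P M : Matrix α α ℂ) :
    ((1 / 2 : ℂ) • P + (1 / 2 : ℂ) • M) * ((1 / 2 : ℂ) • P + (1 / 2 : ℂ) • M) +
      ((1 / (2 * Complex.I) : ℂ) • P + (-(1 / (2 * Complex.I)) : ℂ) • M) *
        ((1 / (2 * Complex.I) : ℂ) • P + (-(1 / (2 * Complex.I)) : ℂ) • M) =
      (1 / 2 : ℂ) • (P * M + M * P) := by
  have hk : (1 / (2 * Complex.I) : ℂ) * (1 / (2 * Complex.I)) = -1 / 4 := by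
    rw [div_mul_div_comm, mul_mul_mul_comm, Complex.I_mul_I]; norm_num
  generalize (1 / (2 * Complex.I) : ℂ) = k at hk
  simp only [Matrix.add_mul, Matrix.mul_add, Matrix.smul_mul, Matrix.mul_smul]
  match_scalars <;> first | linear_combination hk | linear_combination -hk

lemma sum_momL_sq_mulVec (hV : (djt Q Nφ Nψ w)ᴴ * djt Q Nφ Nψ w = 1) (t : Triplet Q) :
    (∑ a, momL Q Nφ Nψ w a * momL Q Nφ Nψ w a) *ᵥ (djt Q Nφ Nψ w).col t =
      ((t.j : ℂ) * (t.j + 1)) • (djt Q Nφ Nψ w).col t := by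
  have h1 : t.left + t.left' ≤ Q := t.left_add_left'.trans_le t.twoJ_le
  rw [col_djt, Matrix.mulVec_smul, smul_comm _ (colNorm _ _ _ _ : ℂ), t.j_eq]
  congr 1
  generalize t.left = l at *
  generalize t.left' = l' at *
  generalize (t.right' : ℤ) = z
  simp only [Fin.sum_univ_three, momL_eq, hatL_zero, hatL_one, conjDJT_add, conjDJT_smul,
    sq_add_sq_of_ladder]
  simp only [Matrix.add_mulVec, ← Matrix.mulVec_mulVec, Matrix.smul_mulVec, Matrix.mulVec_smul,
    hatLPlus_mulVec hV h1, hatLMinus_mulVec hV h1, hatL_two_mulVec hV h1]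
  rcases l with _ | l <;> rcases l' with _ | l' <;>
    simp only [Nat.cast_zero, zero_smul, Nat.add_sub_cancel] <;>
    (try rw [hatLMinus_mulVec hV (by omega)]) <;> (try rw [hatLPlus_mulVec hV (by omega)]) <;>
    (try simp only [Nat.add_sub_cancel, Nat.zero_add]) <;>
    match_scalars <;> ring

lemma sum_momR_sq_mulVec (hV : (djt Q Nφ Nψ w)ᴴ * djt Q Nφ Nψ w = 1) (t : Triplet Q) :
    (∑ a, momR Q Nφ Nψ w a * momR Q Nφ Nψ w a) *ᵥ (djt Q Nφ Nψ w).col t =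
      ((t.j : ℂ) * (t.j + 1)) • (djt Q Nφ Nψ w).col t := by
  have h1 : t.left + t.left' ≤ Q := t.left_add_left'.trans_le t.twoJ_le
  rw [col_djt, Matrix.mulVec_smul, smul_comm _ (colNorm _ _ _ _ : ℂ), t.j_eq]
  congr 1
  generalize (t.right' : ℤ) = z
  simp only [Fin.sum_univ_three, momR_eq, hatR_zero, hatR_one, conjDJT_add, conjDJT_smul,
    sq_add_sq_of_ladder]
  simp only [Matrix.add_mulVec, ← Matrix.mulVec_mulVec, Matrix.smul_mulVec, Matrix.mulVec_smul,
    hatRPlus_mulVec hV h1, hatRMinus_mulVec hV h1, hatR_two_mulVec hV h1, sub_add_cancel,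
    add_sub_cancel_right]
  match_scalars
  ring

/-- A matrix that factors through `V†` on the right is determined by its action on the columns
of `V`. -/
lemma eq_of_mulVec_col_eq {M M' : Matrix (Point Nθ Nφ Nψ) (Point Nθ Nφ Nψ) ℂ}
    (hM : M * djt Q Nφ Nψ w * (djt Q Nφ Nψ w)ᴴ = M)
    (hM' : M' * djt Q Nφ Nψ w * (djt Q Nφ Nψ w)ᴴ = M')
    (h : ∀ t, M *ᵥ (djt Q Nφ Nψ w).col t = M' *ᵥ (djt Q Nφ Nψ w).col t) : M = M' := by
  have h1 : M * djt Q Nφ Nψ w = M' * djt Q Nφ Nψ w := by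
    ext p t
    exact congrFun (h t) p
  rw [← hM, h1, hM']

lemma conjDJT_mul_djt_mul_conjTranspose (hV : (djt Q Nφ Nψ w)ᴴ * djt Q Nφ Nψ w = 1)
    (H : Matrix (Triplet Q) (Triplet Q) ℂ) :
    conjDJT Nφ Nψ w H * djt Q Nφ Nψ w * (djt Q Nφ Nψ w)ᴴ = conjDJT Nφ Nψ w H := by
  rw [conjDJT, Matrix.mul_assoc _ _ (djt Q Nφ Nψ w), hV, Matrix.mul_one]

lemma sum_momL_sq_eq_sum_momR_sq (hV : (djt Q Nφ Nψ w)ᴴ * djt Q Nφ Nψ w = 1) :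
    ∑ a, momL Q Nφ Nψ w a * momL Q Nφ Nψ w a = ∑ a, momR Q Nφ Nψ w a * momR Q Nφ Nψ w a := by
  have h : ∀ H : Fin 3 → Matrix (Triplet Q) (Triplet Q) ℂ,
      (∑ a, conjDJT Nφ Nψ w (H a) * conjDJT Nφ Nψ w (H a)) * djt Q Nφ Nψ w * (djt Q Nφ Nψ w)ᴴ =
        ∑ a, conjDJT Nφ Nψ w (H a) * conjDJT Nφ Nψ w (H a) := fun H => by
    simp only [Matrix.sum_mul]
    refine Finset.sum_congr rfl fun a _ => ?_
    rw [Matrix.mul_assoc _ _ (djt Q Nφ Nψ w), Matrix.mul_assoc,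
      conjDJT_mul_djt_mul_conjTranspose hV]
  exact eq_of_mulVec_col_eq (h _) (h _)
    fun t => (sum_momL_sq_mulVec hV t).trans (sum_momR_sq_mulVec hV t).symm

lemma momL_two_mulVec_col (hV : (djt Q Nφ Nψ w)ᴴ * djt Q Nφ Nψ w = 1) (t : Triplet Q) :
    momL Q Nφ Nψ w 2 *ᵥ (djt Q Nφ Nψ w).col t = (t.mL : ℂ) • (djt Q Nφ Nψ w).col t := by
  rw [col_djt, Matrix.mulVec_smul, momL_eq,
    hatL_two_mulVec hV (t.left_add_left'.trans_le t.twoJ_le), smul_comm, t.mL_eq]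
  push_cast; rfl

lemma momR_two_mulVec_col (hV : (djt Q Nφ Nψ w)ᴴ * djt Q Nφ Nψ w = 1) (t : Triplet Q) :
    momR Q Nφ Nψ w 2 *ᵥ (djt Q Nφ Nψ w).col t = (-(t.mR : ℂ)) • (djt Q Nφ Nψ w).col t := by
  have h : ((t.left : ℂ) + t.left') = t.right + t.right' := by
    exact_mod_cast t.left_add_left'.trans t.right_add_right'.symm
  rw [col_djt, Matrix.mulVec_smul, momR_eq,
    hatR_two_mulVec hV (t.left_add_left'.trans_le t.twoJ_le), smul_comm, t.mR_eq, h]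
  congr 1
  push_cast; ring

lemma linearIndependent_col_djt (hV : (djt Q Nφ Nψ w)ᴴ * djt Q Nφ Nψ w = 1) :
    LinearIndependent ℂ (djt Q Nφ Nψ w).col := by
  rw [← Matrix.mulVec_injective_iff]
  intro u v huv
  have := congrArg ((djt Q Nφ Nψ w)ᴴ *ᵥ ·) huv
  simpa only [Matrix.mulVec_mulVec, hV, Matrix.one_mulVec] using this

lemma card_triplet_lt (Q : ℕ) :
    6 * Fintype.card {t : Triplet Q // t.twoJ < Q} = (2 * Q + 1) * (Q + 1) * Q := by
  have h : Fintype.card {t : Triplet Q // t.twoJ < Q} = ∑ k ∈ Finset.range Q, (k + 1) ^ 2 := by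
    rw [Fintype.card_subtype, Finset.card_filter, Fintype.sum_sigma, Fin.sum_univ_castSucc,
      ← Fin.sum_univ_eq_sum_range]
    have h1 : ∀ (k : Fin (Q + 1)) (y : Fin (k.1 + 1) × Fin (k.1 + 1)),
        Triplet.twoJ (⟨k, y⟩ : Triplet Q) = k := fun _ _ => rfl
    simp [h1, sq]
  rw [h]
  clear h
  induction Q with
  | zero => simp
  | succ n ih => rw [Finset.sum_range_succ, mul_add, ih]; ring

lemma finrank_lowSpace (hV : (djt Q Nφ Nψ w)ᴴ * djt Q Nφ Nψ w = 1) :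
    6 * Module.finrank ℂ (lowSpace Q Nφ Nψ w) = (2 * Q + 1) * (Q + 1) * Q := by
  have h1 := (linearIndependent_col_djt hV).comp
    (Subtype.val : {t : Triplet Q // t.twoJ < Q} → Triplet Q) Subtype.val_injective
  have h2 : lowSpace Q Nφ Nψ w = Submodule.span ℂ (Set.range ((djt Q Nφ Nψ w).col ∘
      (Subtype.val : {t : Triplet Q // t.twoJ < Q} → Triplet Q))) := by
    rw [lowSpace]
    congr 1
    ext v
    constructor
    · rintro ⟨t, ht, rfl⟩; exact ⟨⟨t, ht⟩, rfl⟩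
    · rintro ⟨⟨t, ht⟩, rfl⟩; exact ⟨t, ht, rfl⟩
  rw [h2, finrank_span_eq_card h1, card_triplet_lt]

end Commutation
end DJT
end

open DJT in
theorem mainTheorem2 (Q Nθ Nφ Nψ : ℕ) (hθ : Q < 2 * Nθ) (hφ : 2 * Q < Nφ) (hψ : 2 * Q < Nψ) :
    Fintype.card (Node Nθ) = Nθ ∧
    (∃! w : Node Nθ → ℝ, IsGaussianWeights Nθ w) ∧
    ∀ w : Node Nθ → ℝ, IsGaussianWeights Nθ w →
      -- the weights are positive and the columns of `V` are orthonormal: `V†` inverts `V`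
      (∀ s, 0 < w s) ∧
      (djt Q Nφ Nψ w)ᴴ * djt Q Nφ Nψ w = 1 ∧
      -- the columns are joint eigenvectors of `∑ L_a² = ∑ R_a²`, `L_3` and `R_3`
      (∑ a, momL Q Nφ Nψ w a * momL Q Nφ Nψ w a = ∑ a, momR Q Nφ Nψ w a * momR Q Nφ Nψ w a) ∧
      (∀ t : Triplet Q,
        (∑ a, momL Q Nφ Nψ w a * momL Q Nφ Nψ w a) *ᵥ (djt Q Nφ Nψ w).col t =
          ((t.j : ℂ) * (t.j + 1)) • (djt Q Nφ Nψ w).col t ∧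
        momL Q Nφ Nψ w 2 *ᵥ (djt Q Nφ Nψ w).col t = (t.mL : ℂ) • (djt Q Nφ Nψ w).col t ∧
        momR Q Nφ Nψ w 2 *ᵥ (djt Q Nφ Nψ w).col t = (-(t.mR : ℂ)) • (djt Q Nφ Nψ w).col t) ∧
      -- those with `j ≤ q - 1/2` span a space of dimension `N_{q-1/2}`
      6 * Module.finrank ℂ (lowSpace Q Nφ Nψ w) = (2 * Q + 1) * (Q + 1) * Q ∧
      -- on that space the canonical commutation relations hold, for each entry `(c, d)` of `U`
      ∀ Φ ∈ lowSpace Q Nφ Nψ w, ∀ (a : Fin 3) (c d : Fin 2),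
        (momL Q Nφ Nψ w a * link Nθ Nφ Nψ c d - link Nθ Nφ Nψ c d * momL Q Nφ Nψ w a) *ᵥ Φ =
          -((∑ e, tau a c e • link Nθ Nφ Nψ e d) *ᵥ Φ) ∧
        (momR Q Nφ Nψ w a * link Nθ Nφ Nψ c d - link Nθ Nφ Nψ c d * momR Q Nφ Nψ w a) *ᵥ Φ =
          (∑ e, tau a e d • link Nθ Nφ Nψ c e) *ᵥ Φ := by
  refine ⟨card_node Nθ, existsUnique_isGaussianWeights Nθ, fun w hw => ?_⟩
  have hV := djt_conjTranspose_mul_self hθ hφ hψ hw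
  refine ⟨hw.pos, hV, sum_momL_sq_eq_sum_momR_sq hV, fun t => ⟨sum_momL_sq_mulVec hV t,
    momL_two_mulVec_col hV t, momR_two_mulVec_col hV t⟩, finrank_lowSpace hV,
    fun Φ hΦ a c d => ⟨?_, mulVec_eq_of_mem_lowSpace
      (fun l l' z hl => rightCommutes_hatR hV a l l' z hl c d) hΦ⟩⟩
  rw [← Matrix.neg_mulVec]
  refine mulVec_eq_of_mem_lowSpace (fun l l' z hl => ?_) hΦ
  rw [Matrix.neg_mulVec]
  exact leftCommutes_hatL hV a l l' z hl c d
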